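/- All graphs are finite and simple; $v(\cdot)$ denotes the number of vertices, and $N(v)$ and $d_G(v)$ denote the neighbourhood and the degree of $v$ in $G$. Let $H$ be an induced subgraph of a graph $G$. The \emph{coboundary} of $H$ in $G$ is the set $\bigcup_{v\in V(H)} N(v)\setminus V(H)$. For real $C,k>0$, we say that $H$ is \begin{itemize} \item a \emph{purse} if $H$ is connected, its coboundary $S$ has size at most two, and the graph obtained from $G[S\cup V(H)]$ by adding all missing edges $uv$ with $u\neq v\in S$ is planar; \item a \emph{$C$-pocket} if $H$ is connected, $v(H)\le C$, and $d_G(v)\le C$ for every $v\in V(H)$; \item \emph{$k$-deep} if its coboundary is non-empty and has size at most $\frac1k v(H)$. \end{itemize} (Connected graphs are non-empty.) Two subgraphs of $G$ are \emph{non-touching} if they have no vertex in common and no edge of $G$ joins a vertex of one to a vertex of the other. A \emph{$C$-wallet} of $G$ is a set $\mathcal H$ of pairwise non-touching induced subgraphs of $G$, each of which is a $C$-pocket, with $|\mathcal H|\ge \frac{1}{2C}v(G)$. A $C$-wallet $\mathcal H$ is \emph{$k$-deep} if every $H\in\mathcal H$ is a purse or $k$-deep. \textbf{Theorem.} For every real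 $k\ge 1$ there exists a real $C>0$ such that every planar graph $G$ has a $k$-deep $C$-wallet. -/

import Mathlib

namespace SimpleGraph

/-- A drawing of `G` in the Euclidean plane without crossings: vertices are distinct points, every
edge is a simple arc joining its two ends, the interior of an arc contains no vertex, and the
interiors of the arcs of different edges are disjoint. -/
structure PlaneDrawing {V : Type*} (G : SimpleGraph V) where
  point : V → EuclideanSpace ℝ (Fin 2)
  point_injective : Function.Injective point
  arc : G.edgeSet → unitInterval → EuclideanSpace ℝ (Fin 2)
  arc_continuous : ∀ e, Continuous (arc e)
  arc_injective : ∀ e, Function.Injective (arc e)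
  arc_ends : ∀ e, s(arc e 0, arc e 1) = Sym2.map point e.1
  arc_ne_point : ∀ e t, 0 < t → t < 1 → ∀ v, arc e t ≠ point v
  arc_ne_arc : ∀ e e', e ≠ e' → ∀ t t', 0 < t → t < 1 → 0 < t' → t' < 1 → arc e t ≠ arc e' t'

/-- A graph is planar if it can be drawn in the plane without crossings. -/
def IsPlanar {V : Type*} (G : SimpleGraph V) : Prop :=
  Nonempty (PlaneDrawing G)

namespace Subgraph

variable {V : Type*} {G : SimpleGraph V}

/-- The coboundary of `H` in `G`: the vertices outside `H` with a `G`-neighbour in `H`. -/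
def coboundary (H : G.Subgraph) : Set V :=
  {w | w ∉ H.verts ∧ ∃ v ∈ H.verts, G.Adj v w}

/-- The subgraph of `G` induced on the vertices of `H` together with its coboundary, with all edges
between distinct vertices of the coboundary added. -/
def closureGraph (H : G.Subgraph) : SimpleGraph ↥(H.coboundary ∪ H.verts) :=
  G.induce (H.coboundary ∪ H.verts) ⊔
    SimpleGraph.fromRel (fun u v => (u : V) ∈ H.coboundary ∧ (v : V) ∈ H.coboundary)

/-- `H` is a purse (for induced `H`, in a finite graph). -/
def IsPurse (H : G.Subgraph) : Prop :=
  H.Connected ∧ H.coboundary.ncard ≤ 2 ∧ H.closureGraph.IsPlanar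

/-- `H` is a `C`-pocket (for induced `H`, in a finite graph): it is connected, has at most `C`
vertices, and each of its vertices has degree at most `C` in `G`. -/
def IsPocket (H : G.Subgraph) (C : ℝ) : Prop :=
  H.Connected ∧ (H.verts.ncard : ℝ) ≤ C ∧ ∀ v ∈ H.verts, ((G.neighborSet v).ncard : ℝ) ≤ C

/-- `H` is `k`-deep (for induced `H`, in a finite graph). -/
def IsDeep (H : G.Subgraph) (k : ℝ) : Prop :=
  H.coboundary.Nonempty ∧ (H.coboundary.ncard : ℝ) ≤ 1 / k * H.verts.ncard

/-- Two subgraphs of `G` are non-touching if they have no common vertex and no edge of `G` joins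
a vertex of one to a vertex of the other. -/
def NonTouching (H₁ H₂ : G.Subgraph) : Prop :=
  Disjoint H₁.verts H₂.verts ∧ ∀ a₁ ∈ H₁.verts, ∀ a₂ ∈ H₂.verts, ¬ G.Adj a₁ a₂

end Subgraph

/-- A `C`-wallet of a finite graph `G`: a set of at least `v(G) / (2C)` pairwise non-touching
induced subgraphs, each a `C`-pocket. -/
structure IsWallet {V : Type*} (G : SimpleGraph V) (C : ℝ) (ℋ : Set G.Subgraph) : Prop where
  induced : ∀ H ∈ ℋ, H.IsInduced
  pocket : ∀ H ∈ ℋ, H.IsPocket C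
  nonTouching : ∀ H₁ ∈ ℋ, ∀ H₂ ∈ ℋ, H₁ ≠ H₂ → H₁.NonTouching H₂
  card_le : 1 / (2 * C) * (Nat.card V : ℝ) ≤ (ℋ.ncard : ℝ)

/-- A `k`-deep `C`-wallet: every member is a purse or `k`-deep. -/
structure IsDeepWallet {V : Type*} (G : SimpleGraph V) (k C : ℝ) (ℋ : Set G.Subgraph) : Prop
    extends IsWallet G C ℋ where
  purse_or_deep : ∀ H ∈ ℋ, H.IsPurse ∨ H.IsDeep k

end SimpleGraph

/-!
Planarity enters twice: a planar graph has no `K₃,₃` minor (`IsPlanar.k33MinorFree`), and a path of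
a plane graph can be used to draw an additional edge between its ends (`IsPlanar.isPurse`).

The pockets are components of `G - Y` for a small set `Y` of vertices. A graph without a `K₃,₃`
minor has a linear number of edges (`K33MinorFree.degreeSumOn_le`), so the set of all vertices of
large degree is small. In the rest of the graph, repeat three times: choose a root in every
component and delete every `Δ`-th level of the distance to the root. If a component remained that
contains three vertices far apart from each other, then three short paths from each of them towards
the three roots, and the parts of the graph near these roots, would form a `K₃,₃` minor
(`K33MinorFree.exists_chop`). So every remaining component is covered by two balls, and its size is
bounded in terms of `Δ` and the degrees (`K33MinorFree.exists_small_components`). This is the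
decomposition of Klein, Plotkin and Rao. Let `Y` consist of all deleted vertices.

Contracting the components of `G - Y` gives a bipartite minor of `G`. The components with at least
three neighbours in `Y` are linear in number with respect to `Y`
(`K33MinorFree.card_le_of_three_le`): match as many components as possible to pairs of their
neighbours. The matched pairs are the edges of a minor on `Y`, hence few, and every unmatched
component sees a triangle of that minor; there are few triangles, and no three components see the
same one. A component with two neighbours is a purse if another component is adjacent to
both, because a path through the other one draws the missing edge. The components with two
neighbours that share these with no other component are again the edges of a minor on `Y`. So all
components that are not purses have together `O(|Y|)` neighbours
(`IsPlanar.sum_card_rightNeighbors_le`), and those of them that are not `k`-deep have together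
`O(k|Y|)` vertices. If `Y` is small enough, at least half of the vertices of `G` are in components
that are purses or `k`-deep (`IsPlanar.exists_isDeepWallet`).

That `K₃,₃` has no drawing is shown without the Jordan curve theorem, for arbitrary continuous
curves (`not_forall_disjoint_curves`). For two disjoint curves `e` and `f`, the function
`e s - f t` on the square has a continuous logarithm, which gives a linear relation between the
angles swept by each curve as seen from the ends of the other. Compared with the directions between
the six points, these angles are given by integers. The relations for the eighteen pairs of
independent edges of `K₃,₃` contradict each other modulo two.
-/

section DisjointCurves

open unitInterval

/-! ### Curves in the plane -/

/-- A nowhere vanishing continuous function on a retract of a simply connected, locally path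
connected space has a continuous logarithm. -/
theorem exists_continuous_log {A X : Type*} [TopologicalSpace A] [TopologicalSpace X]
    [SimplyConnectedSpace X] [LocallyPathConnectedSpace X] {ι : A → X} {ρ : X → A}
    (hι : Continuous ι) (hρ : Continuous ρ) (hρι : ∀ a, ρ (ι a) = a)
    {f : A → ℂ} (hf : Continuous f) (h0 : ∀ a, f a ≠ 0) :
    ∃ g : A → ℂ, Continuous g ∧ ∀ a, Complex.exp (g a) = f a := by
  have x₀ : X := Classical.arbitrary X
  obtain ⟨F, ⟨-, hF⟩, -⟩ := Complex.isCoveringMapOn_exp.existsUnique_continuousMap_lifts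
    (⟨f ∘ ρ, hf.comp hρ⟩ : C(X, ℂ)) (a₀ := x₀) (e₀ := Complex.log (f (ρ x₀)))
    (Complex.exp_log (h0 _)) (fun a => h0 _)
  refine ⟨F ∘ ι, F.continuous.comp hι, fun a => ?_⟩
  have := congrFun hF (ι a)
  simpa [hρι] using this

theorem exists_continuous_log_unitInterval {f : I → ℂ} (hf : Continuous f) (h0 : ∀ a, f a ≠ 0) :
    ∃ g : I → ℂ, Continuous g ∧ ∀ a, Complex.exp (g a) = f a :=
  exists_continuous_log (X := ℝ) continuous_subtype_val
    (continuous_projIcc (h := zero_le_one)) (Set.projIcc_val zero_le_one) hf h0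

theorem exists_continuous_log_square {f : I × I → ℂ} (hf : Continuous f) (h0 : ∀ a, f a ≠ 0) :
    ∃ g : I × I → ℂ, Continuous g ∧ ∀ a, Complex.exp (g a) = f a :=
  exists_continuous_log (X := ℝ × ℝ) (ι := Prod.map Subtype.val Subtype.val)
    (ρ := Prod.map (Set.projIcc 0 1 zero_le_one) (Set.projIcc 0 1 zero_le_one))
    (by fun_prop) (by fun_prop)
    (fun _ => Prod.ext (Set.projIcc_val zero_le_one _) (Set.projIcc_val zero_le_one _)) hf h0

/-- Two continuous logarithms of the same function differ by a constant. -/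
theorem sub_eq_sub_of_exp_eq {g g' : I → ℂ} (hg : Continuous g) (hg' : Continuous g')
    (h : ∀ t, Complex.exp (g t) = Complex.exp (g' t)) : g 1 - g 0 = g' 1 - g' 0 := by
  have h' : ∀ t, Complex.exp (g' t + (g 0 - g' 0)) = Complex.exp (g t) := fun t => by
    simp [Complex.exp_add, Complex.exp_sub, h]
  have h3 := congrFun (Complex.isCoveringMap_exp.eq_of_comp_eq hg
    (g₂ := fun t => g' t + (g 0 - g' 0)) (by fun_prop)
    (funext fun t => Subtype.ext (h' t).symm) 0 (by simp)) 1
  rw [h3]; ring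

/-- The variation of a continuous logarithm of `t ↦ f t - a` along the curve `f`, so that its
imaginary part is the angle swept by `f` as seen from `a`. It is meaningful if `f` is continuous
and avoids `a`. -/
noncomputable def logVariation (a : ℂ) (f : I → ℂ) : ℂ :=
  open Classical in
  if h : ∃ g : I → ℂ, Continuous g ∧ ∀ t, Complex.exp (g t) = f t - a then
    h.choose 1 - h.choose 0 else 0

theorem logVariation_eq {a : ℂ} {f g : I → ℂ} (hg : Continuous g)
    (h : ∀ t, Complex.exp (g t) = f t - a) : logVariation a f = g 1 - g 0 := by
  have h' : ∃ g : I → ℂ, Continuous g ∧ ∀ t, Complex.exp (g t) = f t - a := ⟨g, hg, h⟩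
  rw [logVariation, dif_pos h']
  exact sub_eq_sub_of_exp_eq h'.choose_spec.1 hg fun t => by rw [h'.choose_spec.2, h]

/-- A continuous logarithm of `e s - f t` on the square has total variation zero along the
boundary. -/
theorem logVariation_add_eq_add {e f : I → ℂ} (he : Continuous e) (hf : Continuous f)
    (h : ∀ s t, e s ≠ f t) :
    logVariation (f 0) e + logVariation (e 1) f = logVariation (e 0) f + logVariation (f 1) e := by
  obtain ⟨g, hg, hgf⟩ := exists_continuous_log_square (f := fun x => e x.1 - f x.2)
    (by fun_prop) (fun x => sub_ne_zero.2 (h _ _))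
  have hE : ∀ t, logVariation (f t) e = g (1, t) - g (0, t) := fun t =>
    logVariation_eq (g := fun s => g (s, t)) (by fun_prop) fun s => hgf (s, t)
  have hF : ∀ s, logVariation (e s) f = g (s, 1) - g (s, 0) := fun s => by
    rw [logVariation_eq (g := fun t => g (s, t) + Real.pi * Complex.I) (by fun_prop) fun t => by
      rw [Complex.exp_add, hgf, Complex.exp_pi_mul_I]; ring]
    ring
  rw [hE, hE, hF, hF]; ring

/-- Prescribed logarithms of the end points determine the variation up to the number of turns of the
curve around `a`. -/
theorem exists_logVariation_eq {a x y : ℂ} {f : I → ℂ} (hf : Continuous f) (h : ∀ t, f t ≠ a)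
    (hx : Complex.exp x = f 0 - a) (hy : Complex.exp y = f 1 - a) :
    ∃ m : ℤ, logVariation a f = y - x + 2 * Real.pi * Complex.I * m := by
  obtain ⟨g, hg, hgf⟩ := exists_continuous_log_unitInterval (f := fun t => f t - a) (by fun_prop)
    (fun t => sub_ne_zero.2 (h t))
  obtain ⟨m, hm⟩ := Complex.exp_eq_exp_iff_exists_int.1 ((hgf 0).trans hx.symm)
  obtain ⟨n, hn⟩ := Complex.exp_eq_exp_iff_exists_int.1 ((hgf 1).trans hy.symm)
  refine ⟨n - m, ?_⟩
  rw [logVariation_eq hg hgf, hm, hn]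
  push_cast
  ring

/-- Logarithms of the differences `p k - p i`, normalized so that exchanging the points of a
pair `i < k` adds `π * I`. -/
theorem exists_log_sub (p : Fin 3 → ℂ) (hp : Function.Injective p) :
    ∃ P : Fin 3 → Fin 3 → ℂ, (∀ i k, i ≠ k → Complex.exp (P i k) = p k - p i) ∧
      ∀ i k, i < k → P k i = P i k + Real.pi * Complex.I := by
  refine ⟨fun i k => if i < k then Complex.log (p k - p i) else
    Complex.log (p i - p k) + Real.pi * Complex.I, fun i k hik => ?_, fun i k hik => ?_⟩
  · dsimp only
    split_ifs with h
    · exact Complex.exp_log (sub_ne_zero.2 (hp.ne hik.symm))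
    · rw [Complex.exp_add, Complex.exp_log (sub_ne_zero.2 (hp.ne hik)), Complex.exp_pi_mul_I]
      ring
  · simp [hik, hik.le]

/-- There is no drawing of `K₃,₃` in the plane in which independent edges are disjoint, even if the
curves that represent the edges are not simple. -/
theorem not_forall_disjoint_curves {p q : Fin 3 → ℂ} {γ : Fin 3 → Fin 3 → I → ℂ}
    (hc : ∀ i j, Continuous (γ i j)) (h0 : ∀ i j, γ i j 0 = p i) (h1 : ∀ i j, γ i j 1 = q j)
    (hd : ∀ i j k l, i ≠ k → j ≠ l → ∀ s t, γ i j s ≠ γ k l t) : False := by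
  have hne : ∀ j : Fin 3, ∃ l, j ≠ l := by decide
  have hp : Function.Injective p := fun i k hik => by
    by_contra h
    exact hd i 0 k 1 h (by decide) 0 0 (by rw [h0, h0, hik])
  have hq : Function.Injective q := fun j l hjl => by
    by_contra h
    exact hd 0 j 1 l (by decide) h 1 1 (by rw [h1, h1, hjl])
  have hpq : ∀ i l, q l - p i ≠ 0 := fun i l => by
    obtain ⟨k, hk⟩ := hne i
    obtain ⟨j, hj⟩ := hne l
    have := hd i j k l hk hj.symm 0 1
    rw [h0, h1] at this
    exact sub_ne_zero.2 this.symm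
  have hpγ : ∀ k i j, k ≠ i → ∀ t, γ i j t ≠ p k := fun k i j hk t => by
    obtain ⟨l, hl⟩ := hne j
    have := hd i j k l hk.symm hl t 0
    rwa [h0] at this
  have hqγ : ∀ l i j, l ≠ j → ∀ t, γ i j t ≠ q l := fun l i j hl t => by
    obtain ⟨k, hk⟩ := hne i
    have := hd i j k l hk hl.symm t 1
    rwa [h1] at this
  obtain ⟨P, hP, hP'⟩ := exists_log_sub p hp
  obtain ⟨Q, hQ, hQ'⟩ := exists_log_sub q hq
  have hm : ∀ k i j, ∃ m : ℤ, k ≠ i → logVariation (p k) (γ i j) =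
      Complex.log (q j - p k) - P k i + 2 * Real.pi * Complex.I * m := fun k i j => by
    by_cases hk : k = i
    · exact ⟨0, fun h => absurd hk h⟩
    · obtain ⟨m, hm⟩ := exists_logVariation_eq (hc i j) (hpγ k i j hk)
        (x := P k i) (y := Complex.log (q j - p k)) (by rw [hP _ _ hk, h0])
        (by rw [Complex.exp_log (hpq _ _), h1])
      exact ⟨m, fun _ => hm⟩
  have hn : ∀ l i j, ∃ m : ℤ, l ≠ j → logVariation (q l) (γ i j) =
      Q l j - (Complex.log (q l - p i) + Real.pi * Complex.I) + 2 * Real.pi * Complex.I * m :=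
    fun l i j => by
    by_cases hl : l = j
    · exact ⟨0, fun h => absurd hl h⟩
    · obtain ⟨m, hm⟩ := exists_logVariation_eq (hc i j) (hqγ l i j hl)
        (x := Complex.log (q l - p i) + Real.pi * Complex.I) (y := Q l j)
        (by rw [Complex.exp_add, Complex.exp_log (hpq _ _), h0, Complex.exp_pi_mul_I]; ring)
        (by rw [hQ _ _ hl, h1])
      exact ⟨m, fun _ => hm⟩
  choose m hm using hm
  choose n hn using hn
  have hpi : (2 * Real.pi * Complex.I : ℂ) ≠ 0 := Complex.two_pi_I_ne_zero
  have key : ∀ i k j l, i ≠ k → j ≠ l → (P i k - P k i) + (Q j l - Q l j) +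
      2 * Real.pi * Complex.I * (m k i j + n j k l - m i k l - n l i j) = 0 := by
    intro i k j l hik hjl
    have h := logVariation_add_eq_add (hc i j) (hc k l) (hd i j k l hik hjl)
    rw [h0, h0, h1, h1, hm _ _ _ hik.symm, hm _ _ _ hik, hn _ _ _ hjl, hn _ _ _ hjl.symm] at h
    linear_combination h
  -- The pairs that interleave in the linear order `p 0, p 1, p 2, q 0, q 1, q 2` contribute `1`.
  have k1 : ∀ i k j l, i < k → j < l → m k i j + n j k l - m i k l - n l i j = 1 := by
    intro i k j l hik hjl
    have h := key i k j l hik.ne hjl.ne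
    rw [hP' _ _ hik, hQ' _ _ hjl] at h
    have h2 : (2 * Real.pi * Complex.I : ℂ) *
        (m k i j + n j k l - m i k l - n l i j - 1) = 0 := by linear_combination h
    have h3 := (mul_eq_zero.1 h2).resolve_left hpi
    have h4 : ((m k i j + n j k l - m i k l - n l i j - 1 : ℤ) : ℂ) = 0 := by
      push_cast; exact h3
    have := Int.cast_eq_zero.1 h4
    linarith
  have k2 : ∀ i k j l, i < k → l < j → m k i j + n j k l - m i k l - n l i j = 0 := by
    intro i k j l hik hjl
    have h := key i k j l hik.ne hjl.ne'
    rw [hP' _ _ hik, hQ' _ _ hjl] at h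
    have h2 : (2 * Real.pi * Complex.I : ℂ) *
        (m k i j + n j k l - m i k l - n l i j) = 0 := by linear_combination h
    have h3 := (mul_eq_zero.1 h2).resolve_left hpi
    exact_mod_cast h3
  -- Each of the integers `m k i j` and `n l i j` occurs in two of the following eighteen relations,
  -- so that the left sides have an even sum. Nine of the right sides are `1`, the others are `0`.
  have a01 : (0 : Fin 3) < 1 := by decide
  have a02 : (0 : Fin 3) < 2 := by decide
  have a12 : (1 : Fin 3) < 2 := by decide
  have := k1 0 1 0 1 a01 a01
  have := k1 0 1 0 2 a01 a02
  have := k1 0 1 1 2 a01 a12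
  have := k1 0 2 0 1 a02 a01
  have := k1 0 2 0 2 a02 a02
  have := k1 0 2 1 2 a02 a12
  have := k1 1 2 0 1 a12 a01
  have := k1 1 2 0 2 a12 a02
  have := k1 1 2 1 2 a12 a12
  have := k2 0 1 1 0 a01 a01
  have := k2 0 1 2 0 a01 a02
  have := k2 0 1 2 1 a01 a12
  have := k2 0 2 1 0 a02 a01
  have := k2 0 2 2 0 a02 a02
  have := k2 0 2 2 1 a02 a12
  have := k2 1 2 1 0 a12 a01
  have := k2 1 2 2 0 a12 a02
  have := k2 1 2 2 1 a12 a12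
  omega

end DisjointCurves

namespace SimpleGraph

section PlanarMinors

open unitInterval

/-! ### Connected sets of vertices -/

variable {V : Type*} {G : SimpleGraph V}

/-- Some walk of `G` from `x` to `y` has all its vertices in `S`. -/
def LinkedIn (G : SimpleGraph V) (S : Set V) (x y : V) : Prop :=
  ∃ p : G.Walk x y, ∀ z ∈ p.support, z ∈ S

theorem LinkedIn.refl {S : Set V} {x : V} (hx : x ∈ S) : G.LinkedIn S x x :=
  ⟨.nil, by simpa using hx⟩

theorem LinkedIn.symm {S : Set V} {x y : V} (h : G.LinkedIn S x y) : G.LinkedIn S y x := by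
  obtain ⟨p, hp⟩ := h
  exact ⟨p.reverse, by simpa using hp⟩

theorem LinkedIn.trans {S : Set V} {x y z : V} (h : G.LinkedIn S x y) (h' : G.LinkedIn S y z) :
    G.LinkedIn S x z := by
  obtain ⟨p, hp⟩ := h
  obtain ⟨q, hq⟩ := h'
  refine ⟨p.append q, fun w hw => ?_⟩
  rcases (Walk.mem_support_append_iff _ _).1 hw with h | h
  exacts [hp _ h, hq _ h]

theorem LinkedIn.mono {S T : Set V} (hST : S ⊆ T) {x y : V} (h : G.LinkedIn S x y) :
    G.LinkedIn T x y := by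
  obtain ⟨p, hp⟩ := h
  exact ⟨p, fun z hz => hST (hp z hz)⟩

theorem LinkedIn.of_adj {S : Set V} {x y : V} (h : G.Adj x y) (hx : x ∈ S) (hy : y ∈ S) :
    G.LinkedIn S x y :=
  ⟨h.toWalk, by simp [hx, hy]⟩

theorem LinkedIn.left_mem {S : Set V} {x y : V} (h : G.LinkedIn S x y) : x ∈ S := by
  obtain ⟨p, hp⟩ := h
  exact hp _ p.start_mem_support

theorem LinkedIn.right_mem {S : Set V} {x y : V} (h : G.LinkedIn S x y) : y ∈ S :=
  h.symm.left_mem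

/-- A relation that holds along the edges inside `S`, and is reflexive and transitive, holds between
vertices that are linked in `S`. -/
theorem LinkedIn.lift {S : Set V} {r : V → V → Prop} (hr : ∀ x ∈ S, r x x)
    (ht : ∀ x y z, r x y → r y z → r x z)
    (ha : ∀ x ∈ S, ∀ y ∈ S, G.Adj x y → r x y) {x y : V} (h : G.LinkedIn S x y) : r x y := by
  obtain ⟨p, hp⟩ := h
  induction p with
  | nil => exact hr _ (hp _ (by simp))
  | cons hadj p ih =>
    have hp' : ∀ z ∈ p.support, z ∈ S := fun z hz => hp z (by simp [hz])
    exact ht _ _ _ (ha _ (hp _ (by simp)) _ (hp' _ p.start_mem_support) hadj) (ih hp')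

/-- `S` induces a connected (in particular non-empty) subgraph of `G`. -/
def ConnectedOn (G : SimpleGraph V) (S : Set V) : Prop :=
  S.Nonempty ∧ ∀ ⦃x⦄, x ∈ S → ∀ ⦃y⦄, y ∈ S → G.LinkedIn S x y

theorem ConnectedOn.of_center {S : Set V} {x : V} (hx : x ∈ S) (h : ∀ y ∈ S, G.LinkedIn S x y) :
    G.ConnectedOn S :=
  ⟨⟨x, hx⟩, fun y hy z hz => (h y hy).symm.trans (h z hz)⟩

theorem ConnectedOn.singleton (x : V) : G.ConnectedOn {x} :=
  .of_center rfl fun y hy => by rw [Set.mem_singleton_iff] at hy; subst hy; exact .refl rfl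

theorem ConnectedOn.union_of_adj {S T : Set V} (hS : G.ConnectedOn S) (hT : G.ConnectedOn T)
    {x y : V} (hx : x ∈ S) (hy : y ∈ T) (h : G.Adj x y) : G.ConnectedOn (S ∪ T) :=
  .of_center (Or.inl hx) fun z hz => by
    rcases hz with hz | hz
    · exact (hS.2 hx hz).mono Set.subset_union_left
    · exact (LinkedIn.of_adj h (Or.inl hx) (Or.inr hy)).trans
        ((hT.2 hy hz).mono Set.subset_union_right)

theorem ConnectedOn.union_of_mem {S T : Set V} (hS : G.ConnectedOn S) (hT : G.ConnectedOn T)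
    {x : V} (hx : x ∈ S) (hy : x ∈ T) : G.ConnectedOn (S ∪ T) :=
  .of_center (Or.inl hx) fun z hz => by
    rcases hz with hz | hz
    · exact (hS.2 hx hz).mono Set.subset_union_left
    · exact (hT.2 hy hz).mono Set.subset_union_right

theorem ConnectedOn.connected_induce {S : Set V} (h : G.ConnectedOn S) :
    (G.induce S).Connected := by
  obtain ⟨⟨x, hx⟩, h⟩ := h
  refine (connected_iff _).2 ⟨fun a b => ?_, ⟨⟨x, hx⟩⟩⟩
  obtain ⟨p, hp⟩ := h a.2 b.2
  exact ⟨p.induce S hp⟩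

/-! ### Minors -/

/-- `H` is a minor of `G`: there are disjoint connected branch sets in `G`, one for each vertex of
`H`, such that adjacent vertices of `H` have branch sets joined by an edge of `G`. -/
def IsMinorOf {W : Type*} (H : SimpleGraph W) (G : SimpleGraph V) : Prop :=
  ∃ β : W → Set V, (∀ w, G.ConnectedOn (β w)) ∧ (∀ w w', w ≠ w' → Disjoint (β w) (β w')) ∧
    ∀ w w', H.Adj w w' → ∃ x ∈ β w, ∃ y ∈ β w', G.Adj x y

theorem ConnectedOn.biUnion {W : Type*} {H : SimpleGraph W} {β : W → Set V}
    (hβ : ∀ w, G.ConnectedOn (β w))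
    (ha : ∀ w w', H.Adj w w' → ∃ x ∈ β w, ∃ y ∈ β w', G.Adj x y) {U : Set W}
    (hU : H.ConnectedOn U) : G.ConnectedOn (⋃ w ∈ U, β w) := by
  have hsub : ∀ w ∈ U, β w ⊆ ⋃ w ∈ U, β w := fun w hw => Set.subset_biUnion_of_mem hw
  refine ⟨?_, fun x hx y hy => ?_⟩
  · obtain ⟨w, hw⟩ := hU.1
    exact (hβ w).1.mono (hsub w hw)
  · rw [Set.mem_iUnion₂] at hx hy
    obtain ⟨w, hw, hx⟩ := hx
    obtain ⟨w', hw', hy⟩ := hy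
    have key : ∀ x ∈ β w, ∀ y ∈ β w', G.LinkedIn (⋃ w ∈ U, β w) x y :=
      (hU.2 hw hw').lift
        (r := fun w w' => ∀ x ∈ β w, ∀ y ∈ β w', G.LinkedIn (⋃ w ∈ U, β w) x y)
        (fun w hw x hx y hy => ((hβ w).2 hx hy).mono (hsub w hw))
        (fun w₁ w₂ w₃ h h' x hx y hy => by
          obtain ⟨z, hz⟩ := (hβ w₂).1
          exact (h x hx z hz).trans (h' z hz y hy))
        (fun w₁ h₁ w₂ h₂ hadj x hx y hy => by
          obtain ⟨a, ha, b, hb, hab⟩ := ha w₁ w₂ hadj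
          exact (((hβ w₁).2 hx ha).mono (hsub _ h₁)).trans
            ((LinkedIn.of_adj hab (hsub _ h₁ ha) (hsub _ h₂ hb)).trans
              (((hβ w₂).2 hb hy).mono (hsub _ h₂))))
    exact key x hx y hy

theorem IsMinorOf.trans {W U : Type*} {K : SimpleGraph U} {H : SimpleGraph W}
    (h : K.IsMinorOf H) (h' : H.IsMinorOf G) : K.IsMinorOf G := by
  obtain ⟨α, hα, hαd, hαa⟩ := h
  obtain ⟨β, hβ, hβd, hβa⟩ := h'
  refine ⟨fun u => ⋃ w ∈ α u, β w, fun u => .biUnion hβ hβa (hα u), fun u u' hu => ?_,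
    fun u u' hu => ?_⟩
  · rw [Set.disjoint_left]
    intro x hx hx'
    rw [Set.mem_iUnion₂] at hx hx'
    obtain ⟨w, hw, hx⟩ := hx
    obtain ⟨w', hw', hx'⟩ := hx'
    by_cases hww : w = w'
    · subst hww
      exact Set.disjoint_left.1 (hαd u u' hu) hw hw'
    · exact Set.disjoint_left.1 (hβd w w' hww) hx hx'
  · obtain ⟨w, hw, w', hw', hww⟩ := hαa u u' hu
    obtain ⟨x, hx, y, hy, hxy⟩ := hβa w w' hww
    exact ⟨x, Set.mem_biUnion hw hx, y, Set.mem_biUnion hw' hy, hxy⟩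

/-- `G` has no `K₃,₃` minor. -/
def K33MinorFree (G : SimpleGraph V) : Prop :=
  ¬ (completeBipartiteGraph (Fin 3) (Fin 3)).IsMinorOf G

theorem K33MinorFree.of_isMinorOf {W : Type*} {H : SimpleGraph W} (hG : G.K33MinorFree)
    (h : H.IsMinorOf G) : H.K33MinorFree :=
  fun h' => hG (h'.trans h)

theorem K33MinorFree.false_of_sets (hG : G.K33MinorFree) {A B : Fin 3 → Set V}
    (hA : ∀ i, G.ConnectedOn (A i)) (hB : ∀ j, G.ConnectedOn (B j))
    (hAd : ∀ i j, i ≠ j → Disjoint (A i) (A j)) (hBd : ∀ i j, i ≠ j → Disjoint (B i) (B j))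
    (hAB : ∀ i j, Disjoint (A i) (B j)) (h : ∀ i j, ∃ x ∈ A i, ∃ y ∈ B j, G.Adj x y) : False := by
  refine hG ⟨Sum.elim A B, ?_, ?_, ?_⟩
  · rintro (i | j)
    exacts [hA i, hB j]
  · rintro (i | j) (k | l) hne
    · exact hAd i k fun h => hne (h ▸ rfl)
    · exact hAB i l
    · exact (hAB k j).symm
    · exact hBd j l fun h => hne (h ▸ rfl)
  · rintro (i | j) (k | l) hadj
    · simp at hadj
    · exact h i l
    · obtain ⟨x, hx, y, hy, hxy⟩ := h k j
      exact ⟨y, hy, x, hx, hxy.symm⟩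
    · simp at hadj

/-- `K₃,₃` is a subgraph of `K₆`. -/
theorem K33MinorFree.not_top_isMinorOf (hG : G.K33MinorFree) :
    ¬ (⊤ : SimpleGraph (Fin 6)).IsMinorOf G := by
  rintro ⟨β, hβ, hβd, hβa⟩
  refine hG.false_of_sets (A := fun i => β (i.castAdd 3)) (B := fun i => β (i.natAdd 3))
    (fun i => hβ _) (fun i => hβ _) (fun i j hij => hβd _ _ ?_) (fun i j hij => hβd _ _ ?_)
    (fun i j => hβd _ _ ?_) (fun i j => hβa _ _ ?_)
  · simpa only [ne_eq, Fin.ext_iff, Fin.val_castAdd] using hij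
  · simpa only [ne_eq, Fin.ext_iff, Fin.val_natAdd, Nat.add_left_cancel_iff] using hij
  · simp only [ne_eq, Fin.ext_iff, Fin.val_castAdd, Fin.val_natAdd]; omega
  · simp only [top_adj, ne_eq, Fin.ext_iff, Fin.val_castAdd, Fin.val_natAdd]; omega

/-! ### A planar graph has no `K₃,₃` minor -/

namespace PlaneDrawing

variable (D : PlaneDrawing G)

/-- The part of the plane covered by the drawing of the subgraph induced on `S`. -/
def trace (S : Set V) : Set (EuclideanSpace ℝ (Fin 2)) :=
  {z | (∃ x ∈ S, z = D.point x) ∨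
    ∃ e : G.edgeSet, (∀ x ∈ e.1, x ∈ S) ∧ ∃ t : I, 0 < t ∧ t < 1 ∧ z = D.arc e t}

theorem exists_ends (e : G.edgeSet) :
    ∃ x y, e.1 = s(x, y) ∧ D.arc e 0 = D.point x ∧ D.arc e 1 = D.point y := by
  obtain ⟨e, he⟩ := e
  induction e with | _ x y
  have h := D.arc_ends ⟨s(x, y), he⟩
  rw [Sym2.map_mk, Sym2.eq_iff] at h
  rcases h with h | h
  · exact ⟨x, y, rfl, h.1, h.2⟩
  · exact ⟨y, x, Sym2.eq_swap, h.1, h.2⟩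

theorem arc_mem_trace {S : Set V} {e : G.edgeSet} (he : ∀ x ∈ e.1, x ∈ S) (t : I) :
    D.arc e t ∈ D.trace S := by
  obtain ⟨x, y, hxy, h0, h1⟩ := D.exists_ends e
  rcases eq_or_ne t 0 with rfl | ht0
  · exact Or.inl ⟨x, he x (by rw [hxy]; simp), h0⟩
  rcases eq_or_ne t 1 with rfl | ht1
  · exact Or.inl ⟨y, he y (by rw [hxy]; simp), h1⟩
  exact Or.inr ⟨e, he, t, unitInterval.pos_iff_ne_zero.2 ht0, unitInterval.lt_one_iff_ne_one.2 ht1,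
    rfl⟩

theorem disjoint_trace {S T : Set V} (h : Disjoint S T) : Disjoint (D.trace S) (D.trace T) := by
  rw [Set.disjoint_left] at h ⊢
  rintro z (⟨x, hx, rfl⟩ | ⟨e, he, t, ht0, ht1, rfl⟩) (⟨y, hy, hz⟩ | ⟨f, hf, u, hu0, hu1, hz⟩)
  · rw [D.point_injective hz] at hx
    exact h hx hy
  · exact D.arc_ne_point f u hu0 hu1 x hz.symm
  · exact D.arc_ne_point e t ht0 ht1 y hz
  · refine D.arc_ne_arc e f ?_ t u ht0 ht1 hu0 hu1 hz
    rintro rfl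
    obtain ⟨x, y, hxy, -⟩ := D.exists_ends e
    have hx : x ∈ e.1 := by rw [hxy]; simp
    exact h (he x hx) (hf x hx)

theorem joinedIn_trace {S : Set V} {x y : V} (h : G.LinkedIn S x y) :
    JoinedIn (D.trace S) (D.point x) (D.point y) := by
  refine h.lift (r := fun x y => JoinedIn (D.trace S) (D.point x) (D.point y))
    (fun x hx => JoinedIn.refl (Or.inl ⟨x, hx, rfl⟩)) (fun _ _ _ h h' => h.trans h')
    (fun x hx y hy hadj => ?_)
  let e : G.edgeSet := ⟨s(x, y), hadj⟩
  have he : ∀ z ∈ e.1, z ∈ S := by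
    intro z hz
    rcases Sym2.mem_iff.1 hz with rfl | rfl <;> assumption
  have hj : JoinedIn (D.trace S) (D.arc e 0) (D.arc e 1) :=
    ⟨⟨⟨D.arc e, D.arc_continuous e⟩, rfl, rfl⟩, fun t => D.arc_mem_trace he t⟩
  have h := D.arc_ends e
  rw [Sym2.map_mk, Sym2.eq_iff] at h
  rcases h with h | h
  · rwa [h.1, h.2] at hj
  · rw [h.1, h.2] at hj
    exact hj.symm

/-- An edge of a `K₃,₃` minor is represented by a curve in the drawing of the union of two branch
sets. Independent edges have disjoint curves, so `not_forall_disjoint_curves` applies. -/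
theorem k33MinorFree (D : PlaneDrawing G) : G.K33MinorFree := by
  rintro ⟨β, hβ, hβd, hβa⟩
  choose r hr using fun w => (hβ w).1
  have hl : ∀ i j : Fin 3, G.LinkedIn (β (.inl i) ∪ β (.inr j)) (r (.inl i)) (r (.inr j)) := by
    intro i j
    obtain ⟨x, hx, y, hy, hxy⟩ := hβa (.inl i) (.inr j) (by simp)
    exact ((hβ _).union_of_adj (hβ _) hx hy hxy).2 (Or.inl (hr _)) (Or.inr (hr _))
  let Φ := Complex.orthonormalBasisOneI.repr.symm
  have hj := fun i j => D.joinedIn_trace (hl i j)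
  refine not_forall_disjoint_curves (p := fun i => Φ (D.point (r (.inl i))))
    (q := fun j => Φ (D.point (r (.inr j)))) (γ := fun i j t => Φ ((hj i j).somePath t))
    (fun i j => by fun_prop) (by simp) (by simp) fun i j k l hik hjl s t hst => ?_
  have hd : Disjoint (β (.inl i) ∪ β (.inr j)) (β (.inl k) ∪ β (.inr l)) := by
    rw [Set.disjoint_union_left, Set.disjoint_union_right, Set.disjoint_union_right]
    exact ⟨⟨hβd _ _ (by simpa using hik), hβd _ _ (by simp)⟩, hβd _ _ (by simp),
      hβd _ _ (by simpa using hjl)⟩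
  have hmem := (hj i j).somePath_mem s
  rw [Φ.injective hst] at hmem
  exact Set.disjoint_left.1 (D.disjoint_trace hd) hmem ((hj k l).somePath_mem t)

end PlaneDrawing

theorem IsPlanar.k33MinorFree (h : G.IsPlanar) : G.K33MinorFree :=
  h.elim fun D => D.k33MinorFree

end PlanarMinors

/-! ### Edges and triangles of graphs without a complete or `K₃,₃` minor -/

section EdgeBounds

open Finset
open scoped Classical

variable {V : Type*} {G : SimpleGraph V}

/-- The sum of the degrees of the subgraph induced on `W`, which is twice its number of edges. -/
noncomputable def degreeSumOn (G : SimpleGraph V) (W : Finset V) : ℕ :=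
  ∑ x ∈ W, #{y ∈ W | G.Adj x y}

theorem degreeSumOn_eq_erase {W : Finset V} {x : V} (hx : x ∈ W) :
    G.degreeSumOn W = G.degreeSumOn (W.erase x) + 2 * #{y ∈ W | G.Adj x y} := by
  have h1 : #{y ∈ W | G.Adj x y} = #{y ∈ W.erase x | G.Adj x y} := by
    congr 1
    ext y
    simp only [mem_filter, mem_erase]
    exact ⟨fun h => ⟨⟨h.2.ne', h.1⟩, h.2⟩, fun h => ⟨h.1.2, h.2⟩⟩
  have h2 : ∀ z ∈ W.erase x, #{y ∈ W | G.Adj z y} =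
      #{y ∈ W.erase x | G.Adj z y} + if G.Adj x z then 1 else 0 := by
    intro z _
    conv_lhs => rw [← insert_erase hx, filter_insert]
    simp only [G.adj_comm z x]
    split_ifs
    · rw [card_insert_of_notMem (by simp)]
    · rfl
  rw [degreeSumOn, ← add_sum_erase _ _ hx, sum_congr rfl h2, sum_add_distrib, ← card_filter,
    ← degreeSumOn, h1]
  ring

/-- A finite subgraph of average degree at least `2 ^ (t + 1)` contains a complete minor on `t + 1`
vertices. If `U` is a maximal connected set whose contraction keeps the average degree, then the
neighbours of `U` induce a subgraph of minimum degree at least `2 ^ t`; induction applies to it, and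
`U` is a further branch set. -/
theorem exists_complete_minor_of_le_degreeSumOn (t : ℕ) : ∀ W : Finset V, W.Nonempty →
    2 * 2 ^ t * #W ≤ G.degreeSumOn W →
    ∃ β : Fin (t + 1) → Set V, (∀ i, β i ⊆ W) ∧ (∀ i, G.ConnectedOn (β i)) ∧
      ∀ i j, i ≠ j → Disjoint (β i) (β j) ∧ ∃ x ∈ β i, ∃ y ∈ β j, G.Adj x y := by
  induction t with
  | zero =>
    rintro W ⟨w, hw⟩ -
    refine ⟨fun _ => {w}, fun i => by simpa using hw, fun i => .singleton w, fun i j hij => ?_⟩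
    omega
  | succ t ih =>
    intro W
    induction h : #W using Nat.strong_induction_on generalizing W with | _ n ih' =>
    subst h
    intro hW hsum
    set c := 2 ^ (t + 1) with hc
    have hc0 : 0 < c := by positivity
    let nb : Finset V → Finset V := fun U => {y ∈ W \ U | ∃ u ∈ U, G.Adj u y}
    let F : Finset (Finset V) := {U ∈ W.powerset | G.ConnectedOn (U : Set V) ∧
      2 * c * (#(W \ U) + 1) ≤ G.degreeSumOn (W \ U) + 2 * #(nb U)}
    have hF : F.Nonempty := by
      obtain ⟨w, hw⟩ := hW
      refine ⟨{w}, mem_filter.2 ⟨by simpa using hw, by simpa using ConnectedOn.singleton w, ?_⟩⟩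
      have hnb : nb {w} = {y ∈ W | G.Adj w y} := by
        ext y
        simp only [nb, mem_filter, mem_sdiff, mem_singleton, exists_eq_left]
        exact ⟨fun h => ⟨h.1.1, h.2⟩, fun h => ⟨⟨h.1, h.2.ne'⟩, h.2⟩⟩
      rw [hnb, sdiff_singleton_eq_erase, ← degreeSumOn_eq_erase hw, card_erase_add_one hw]
      exact hsum
    obtain ⟨U, hU, hmax⟩ := exists_max_image F card hF
    obtain ⟨hUW, hUc, hUs⟩ := mem_filter.1 hU
    rw [mem_powerset] at hUW
    have hUne : U.Nonempty := by exact_mod_cast hUc.1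
    rcases (nb U).eq_empty_or_nonempty with hN | hN
    · rw [hN, card_empty] at hUs
      have hlt : #(W \ U) < #W := card_lt_card (sdiff_ssubset hUW hUne)
      have hne : (W \ U).Nonempty := by
        rw [nonempty_iff_ne_empty]
        intro h0
        rw [h0, degreeSumOn, sum_empty] at hUs
        simp at hUs
        omega
      obtain ⟨β, h1, h2⟩ := ih' _ hlt (W \ U) rfl hne (by nlinarith)
      exact ⟨β, fun i => (h1 i).trans (by exact_mod_cast sdiff_subset), h2⟩
    · have hdeg : ∀ x ∈ nb U, c ≤ #{y ∈ nb U | G.Adj x y} := by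
        intro x hx
        obtain ⟨hxW, u, hu, hux⟩ := mem_filter.1 hx
        obtain ⟨hxW, hxU⟩ := mem_sdiff.1 hxW
        have hconn : G.ConnectedOn ((insert x U : Finset V) : Set V) := by
          rw [coe_insert, Set.insert_eq, Set.union_comm]
          exact hUc.union_of_adj (.singleton x) hu rfl hux
        have hnot : ¬ 2 * c * (#(W \ insert x U) + 1) ≤
            G.degreeSumOn (W \ insert x U) + 2 * #(nb (insert x U)) := by
          intro hle
          have := hmax (insert x U) (mem_filter.2
            ⟨mem_powerset.2 (insert_subset hxW hUW), hconn, hle⟩)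
          rw [card_insert_of_notMem hxU] at this
          omega
        have hxWU : x ∈ W \ U := mem_sdiff.2 ⟨hxW, hxU⟩
        have herase : W \ insert x U = (W \ U).erase x := by
          ext y
          simp only [mem_sdiff, mem_insert, mem_erase]
          tauto
        have h1 := degreeSumOn_eq_erase (G := G) hxWU
        have h2 := card_erase_add_one hxWU
        rw [herase] at hnot
        have h3 := card_erase_add_one hx
        have h4 : #((nb U).erase x) + #({y ∈ W \ U | G.Adj x y} \ nb U) ≤ #(nb (insert x U)) := by
          rw [← card_union_of_disjoint]
          · apply card_le_card
            intro y hy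
            simp only [mem_union, mem_erase, mem_sdiff, mem_filter, nb] at hy
            simp only [nb, mem_filter, mem_sdiff, mem_insert]
            rcases hy with ⟨hyx, ⟨hyW, hyU⟩, v, hv, hvy⟩ | ⟨⟨⟨hyW, hyU⟩, hxy⟩, -⟩
            · exact ⟨⟨hyW, by tauto⟩, v, Or.inr hv, hvy⟩
            · exact ⟨⟨hyW, by have := hxy.ne'; tauto⟩, x, Or.inl rfl, hxy⟩
          · rw [Finset.disjoint_left]
            intro y hy hy'
            exact (mem_sdiff.1 hy').2 (mem_of_mem_erase hy)
        have h5 : #{y ∈ W \ U | G.Adj x y} ≤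
            #({y ∈ W \ U | G.Adj x y} \ nb U) + #{y ∈ nb U | G.Adj x y} := by
          rw [← card_sdiff_add_card_inter {y ∈ W \ U | G.Adj x y} (nb U)]
          gcongr
          intro y hy
          simp only [mem_inter, mem_filter] at hy ⊢
          exact ⟨hy.2, hy.1.2⟩
        rw [not_le] at hnot
        rw [← h2] at hUs
        have h6 : 2 * c * (#((W \ U).erase x) + 1 + 1) =
          2 * c * (#((W \ U).erase x) + 1) + 2 * c := by ring
        omega
      have hsumN : 2 * 2 ^ t * #(nb U) ≤ G.degreeSumOn (nb U) := by
        have := card_nsmul_le_sum (nb U) _ c hdeg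
        rw [smul_eq_mul] at this
        calc 2 * 2 ^ t * #(nb U) = #(nb U) * c := by rw [hc, pow_succ]; ring
          _ ≤ _ := this
      obtain ⟨β, h1, h2, h3⟩ := ih (nb U) hN hsumN
      have hUβ : ∀ i, Disjoint (U : Set V) (β i) ∧ ∃ x ∈ (U : Set V), ∃ y ∈ β i, G.Adj x y := by
        intro i
        refine ⟨?_, ?_⟩
        · rw [Set.disjoint_left]
          intro y hy hy'
          exact (mem_sdiff.1 (mem_filter.1 (h1 i hy')).1).2 hy
        · obtain ⟨y, hy⟩ := (h2 i).1
          obtain ⟨-, u, hu, huy⟩ := mem_filter.1 (h1 i hy)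
          exact ⟨u, hu, y, hy, huy⟩
      refine ⟨Fin.cons (U : Set V) β, fun i => ?_, fun i => ?_, fun i j hij => ?_⟩
      · cases i using Fin.cases with
        | zero => simpa using hUW
        | succ i =>
          refine (h1 i).trans ?_
          intro y hy
          exact (mem_sdiff.1 (mem_filter.1 hy).1).1
      · cases i using Fin.cases with
        | zero => exact hUc
        | succ i => exact h2 i
      · cases i using Fin.cases with
        | zero =>
          cases j using Fin.cases with
          | zero => exact absurd rfl hij
          | succ j => exact hUβ j
        | succ i =>
          cases j using Fin.cases with
          | zero =>
            obtain ⟨h, x, hx, y, hy, hxy⟩ := hUβ i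
            exact ⟨h.symm, y, hy, x, hx, hxy.symm⟩
          | succ j => exact h3 i j fun h => hij (h ▸ rfl)

theorem K33MinorFree.degreeSumOn_le (hG : G.K33MinorFree) (W : Finset V) :
    G.degreeSumOn W ≤ 64 * #W := by
  by_contra! h
  have hW : W.Nonempty := by
    rw [nonempty_iff_ne_empty]
    rintro rfl
    simp [degreeSumOn] at h
  obtain ⟨β, -, h2, h3⟩ := exists_complete_minor_of_le_degreeSumOn (G := G) 5 W hW
    (by norm_num; omega)
  exact hG.not_top_isMinorOf ⟨β, h2, fun i j hij => (h3 i j hij).1, fun i j hij => (h3 i j hij).2⟩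

theorem K33MinorFree.exists_card_le (hG : G.K33MinorFree) {W : Finset V} (hW : W.Nonempty) :
    ∃ x ∈ W, #{y ∈ W | G.Adj x y} ≤ 64 := by
  apply exists_le_of_sum_le hW
  rw [sum_const, smul_eq_mul, mul_comm]
  exact hG.degreeSumOn_le W

/-- Triangles of a graph without a `K₃,₃` minor, each taken with multiplicity at most two, are
counted by removing vertices of small degree one by one. -/
theorem K33MinorFree.card_triangles_le {A Y : Type*} {M : SimpleGraph Y} (hM : M.K33MinorFree)
    {E : Finset A}
    {T : A → Finset Y} (hT : ∀ c ∈ E, #(T c) = 3)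
    (hadj : ∀ c ∈ E, ∀ y ∈ T c, ∀ z ∈ T c, y ≠ z → M.Adj y z)
    (hmult : ∀ S : Finset Y, #S = 3 → #{c ∈ E | T c = S} ≤ 2) (W : Finset Y) :
    #{c ∈ E | T c ⊆ W} ≤ 8192 * #W := by
  induction h : #W generalizing W with
  | zero =>
    rw [card_eq_zero] at h
    subst h
    rw [mul_zero, Nat.le_zero, card_eq_zero, filter_eq_empty_iff]
    intro c hc hT'
    have := hT c hc
    rw [subset_empty.1 hT', card_empty] at this
    omega
  | succ n ih =>
    obtain ⟨w, hw, hdeg⟩ := hM.exists_card_le (card_pos.1 (by omega : 0 < #W))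
    have h1 := ih (W.erase w) (by rw [card_erase_of_mem hw]; omega)
    have h2 : #{c ∈ E | T c ⊆ W ∧ w ∈ T c} ≤ 2 * #(powersetCard 2 {y ∈ W | M.Adj w y}) := by
      refine card_le_mul_card_image_of_maps_to (f := fun c => (T c).erase w) (fun c hc => ?_) 2
        fun S hS => ?_
      · obtain ⟨hc, hcW, hwc⟩ := mem_filter.1 hc
        rw [mem_powersetCard]
        refine ⟨fun y hy => ?_, by rw [card_erase_of_mem hwc, hT c hc]⟩
        obtain ⟨hyw, hy⟩ := mem_erase.1 hy
        exact mem_filter.2 ⟨hcW hy, hadj c hc w hwc y hy hyw.symm⟩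
      · obtain ⟨hS1, hS2⟩ := mem_powersetCard.1 hS
        have hwS : w ∉ S := fun h => (mem_filter.1 (hS1 h)).2.ne rfl
        refine (card_le_card ?_).trans (hmult (insert w S) (by rw [card_insert_of_notMem hwS, hS2]))
        intro c hc
        simp only [mem_filter] at hc ⊢
        exact ⟨hc.1.1, by rw [← hc.2, insert_erase hc.1.2.2]⟩
    -- At most `64 ^ 2` pairs of neighbours of `w`, each with multiplicity at most two: the constant
    -- is `2 * 64 ^ 2 = 8192`.
    have h3 : #(powersetCard 2 {y ∈ W | M.Adj w y}) ≤ 64 ^ 2 := by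
      rw [card_powersetCard]
      exact (Nat.choose_le_pow _ _).trans (Nat.pow_le_pow_left hdeg 2)
    have h4 : #{c ∈ E | T c ⊆ W} ≤
        #{c ∈ E | T c ⊆ W.erase w} + #{c ∈ E | T c ⊆ W ∧ w ∈ T c} := by
      refine (card_le_card ?_).trans (card_union_le _ _)
      intro c hc
      simp only [mem_union, mem_filter] at hc ⊢
      by_cases hwc : w ∈ T c
      · exact Or.inr ⟨hc.1, hc.2, hwc⟩
      · exact Or.inl ⟨hc.1, subset_erase.2 ⟨hc.2, hwc⟩⟩
    omega

end EdgeBounds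

/-! ### Bipartite graphs without a `K₃,₃` minor -/

section Bipartite

open Finset
open scoped Classical

variable {A Y : Type*} [Fintype Y] {Γ : SimpleGraph (A ⊕ Y)}

/-- The neighbours in `Y` of a vertex of `A`. -/
noncomputable def rightNeighbors (Γ : SimpleGraph (A ⊕ Y)) (c : A) : Finset Y :=
  {y | Γ.Adj (.inl c) (.inr y)}

theorem mem_rightNeighbors {c : A} {y : Y} :
    y ∈ Γ.rightNeighbors c ↔ Γ.Adj (.inl c) (.inr y) := by simp [rightNeighbors]

/-- The number of edges between `E` and `Y` is linear in the number of their ends. -/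
theorem K33MinorFree.sum_card_rightNeighbors_le (hΓ : Γ.K33MinorFree) (E : Finset A) :
    ∑ c ∈ E, #(Γ.rightNeighbors c) ≤ 64 * (#E + Fintype.card Y) := by
  have h := hΓ.degreeSumOn_le (E.disjSum univ)
  rw [card_disjSum, card_univ, degreeSumOn, sum_disjSum] at h
  refine le_trans ?_ ((Nat.le_add_right _ _).trans h)
  refine sum_le_sum fun c _ => ?_
  rw [← card_map ⟨Sum.inr, Sum.inr_injective⟩]
  refine card_le_card fun z hz => ?_
  obtain ⟨y, hy, rfl⟩ := mem_map.1 hz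
  simpa [mem_rightNeighbors] using hy

/-- Vertices of `A` with chosen pairs of neighbours in `Y` give a graph on `Y` with these pairs as
edges; contracting each of the vertices into one end of its pair shows that it is a minor. -/
theorem fromEdgeSet_isMinorOf {E : Finset A} {p : A → Sym2 Y}
    (hp : ∀ c ∈ E, ∀ y ∈ p c, y ∈ Γ.rightNeighbors c) :
    (fromEdgeSet (p '' E)).IsMinorOf Γ := by
  let r : A → Y := fun c => (Quot.out (p c)).1
  have hr : ∀ c, r c ∈ p c := fun c => Sym2.out_fst_mem _
  have key : ∀ y y', (fromEdgeSet (p '' E)).Adj y y' → ∀ c ∈ E, p c = s(y, y') → r c = y →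
      ∃ x ∈ (insert (.inr y) {z | ∃ c ∈ E, r c = y ∧ z = .inl c} : Set (A ⊕ Y)),
      ∃ x' ∈ (insert (.inr y') {z | ∃ c ∈ E, r c = y' ∧ z = .inl c} : Set (A ⊕ Y)),
        Γ.Adj x x' := by
    intro y y' hadj c hc hpc hrc
    exact ⟨.inl c, Or.inr ⟨c, hc, hrc, rfl⟩, .inr y', Or.inl rfl,
      mem_rightNeighbors.1 (hp c hc y' (by simp [hpc]))⟩
  refine ⟨fun y => insert (.inr y) {z | ∃ c ∈ E, r c = y ∧ z = .inl c}, fun y => ?_,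
    fun y y' hy => ?_, fun y y' hadj => ?_⟩
  · refine .of_center (Set.mem_insert _ _) fun z hz => ?_
    rcases hz with rfl | ⟨c, hc, rfl, rfl⟩
    · exact .refl (Set.mem_insert _ _)
    · exact .of_adj (mem_rightNeighbors.1 (hp c hc _ (hr c))).symm (Set.mem_insert _ _)
        (Or.inr ⟨c, hc, rfl, rfl⟩)
  · rw [Set.disjoint_left]
    rintro z (rfl | ⟨c, hc, rfl, rfl⟩) (hz | ⟨c', hc', h1, h2⟩)
    · exact hy (Sum.inr_injective hz)
    · cases h2
    · cases hz
    · rw [Sum.inl_injective h2] at hy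
      exact hy h1
  · obtain ⟨⟨c, hc, hpc⟩, hne⟩ := (fromEdgeSet_adj _).1 hadj
    have h := hr c
    rw [hpc] at h
    rcases Sym2.mem_iff.1 h with h | h
    · exact key y y' hadj c hc hpc h
    · obtain ⟨x, hx, x', hx', hxx⟩ := key y' y hadj.symm c hc (hpc.trans Sym2.eq_swap) h
      exact ⟨x', hx', x, hx, hxx.symm⟩

theorem K33MinorFree.card_le_of_injOn (hΓ : Γ.K33MinorFree) {E : Finset A} {p : A → Sym2 Y}
    (hp : ∀ c ∈ E, ∀ y ∈ p c, y ∈ Γ.rightNeighbors c) (hd : ∀ c ∈ E, ¬ (p c).IsDiag)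
    (hinj : Set.InjOn p E) : #E ≤ 64 * Fintype.card Y := by
  have h := (hΓ.of_isMinorOf (fromEdgeSet_isMinorOf hp)).degreeSumOn_le univ
  obtain ⟨M, hM⟩ : ∃ M, M = fromEdgeSet (p '' (E : Set A)) := ⟨_, rfl⟩
  rw [← hM] at h
  have h3 : M.degreeSumOn univ = ∑ v, M.degree v := by
    refine sum_congr rfl fun y _ => ?_
    rw [← card_neighborFinset_eq_degree]
    congr 1
    ext z
    simp
  rw [h3, M.sum_degrees_eq_twice_card_edges, card_univ] at h
  refine le_trans ?_ (le_trans (Nat.le_mul_of_pos_left _ two_pos) h)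
  rw [← card_image_of_injOn hinj]
  refine card_le_card fun e he => ?_
  obtain ⟨c, hc, rfl⟩ := mem_image.1 he
  rw [mem_edgeFinset, hM, edgeSet_fromEdgeSet]
  exact ⟨⟨c, hc, rfl⟩, hd c hc⟩

theorem K33MinorFree.card_filter_eq_le_two (hΓ : Γ.K33MinorFree) {E : Finset A}
    {T : A → Finset Y} (hT : ∀ c ∈ E, T c ⊆ Γ.rightNeighbors c) {S : Finset Y} (hS : #S = 3) :
    #{c ∈ E | T c = S} ≤ 2 := by
  by_contra! h
  obtain ⟨R, hR, hR3⟩ := exists_subset_card_eq h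
  let a := (equivFinOfCardEq hR3).symm
  let b := (equivFinOfCardEq hS).symm
  refine hΓ.false_of_sets (A := fun i => {.inl (a i : A)}) (B := fun i => {.inr (b i : Y)})
    (fun i => .singleton _) (fun i => .singleton _) (fun i j hij => ?_) (fun i j hij => ?_)
    (fun i j => by simp) (fun i j => ?_)
  · simpa using fun h => hij (a.injective (Subtype.ext h))
  · simpa using fun h => hij (b.injective (Subtype.ext h))
  · refine ⟨_, rfl, _, rfl, ?_⟩
    obtain ⟨h1, h2⟩ := mem_filter.1 (hR (a i).2)
    exact mem_rightNeighbors.1 (hT _ h1 (h2 ▸ (b j).2))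

/-- A maximal matching between the vertices of `E` and the pairs of their neighbours leaves
vertices whose neighbourhoods are cliques of the graph formed by the matched pairs. -/
theorem K33MinorFree.card_le_of_three_le (hΓ : Γ.K33MinorFree) {E : Finset A}
    (hE : ∀ c ∈ E, 3 ≤ #(Γ.rightNeighbors c)) : #E ≤ 8256 * Fintype.card Y := by
  rcases E.eq_empty_or_nonempty with rfl | ⟨c₀, hc₀⟩
  · simp
  let P : Finset A → (A → Sym2 Y) → Prop := fun F p =>
    (∀ c ∈ F, ∀ y ∈ p c, y ∈ Γ.rightNeighbors c) ∧ (∀ c ∈ F, ¬ (p c).IsDiag) ∧ Set.InjOn p F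
  have hne : ({F ∈ E.powerset | ∃ p, P F p} : Finset (Finset A)).Nonempty := by
    refine ⟨∅, mem_filter.2 ⟨empty_mem_powerset _, ?_⟩⟩
    have : (Γ.rightNeighbors c₀).Nonempty := card_pos.1 (by have := hE c₀ hc₀; omega)
    exact ⟨fun _ => s(this.choose, this.choose), by simp [P]⟩
  obtain ⟨F, hF, hmax⟩ := exists_max_image _ card hne
  obtain ⟨hFE, p, hp, hpd, hpi⟩ := mem_filter.1 hF
  rw [mem_powerset] at hFE
  have h1 := hΓ.card_le_of_injOn hp hpd hpi
  have hM := hΓ.of_isMinorOf (fromEdgeSet_isMinorOf hp)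
  have hT : ∀ c, ∃ S : Finset Y, c ∈ E → S ⊆ Γ.rightNeighbors c ∧ #S = 3 := fun c => by
    by_cases hc : c ∈ E
    · obtain ⟨S, hS⟩ := exists_subset_card_eq (hE c hc)
      exact ⟨S, fun _ => hS⟩
    · exact ⟨∅, fun h => absurd h hc⟩
  choose T hT using hT
  have hsub : ∀ c ∈ E \ F, c ∈ E := fun c hc => (mem_sdiff.1 hc).1
  have h2 := hM.card_triangles_le (E := E \ F) (T := T) (fun c hc => (hT c (hsub c hc)).2)
    (fun c hc y hy z hz hyz => ?_)
    (fun S hS => hΓ.card_filter_eq_le_two (fun c hc => (hT c (hsub c hc)).1) hS) univ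
  · rw [filter_true_of_mem (fun c _ => subset_univ _), card_univ] at h2
    have h3 := card_sdiff_add_card_eq_card hFE
    omega
  · obtain ⟨hcE, hcF⟩ := mem_sdiff.1 hc
    rw [fromEdgeSet_adj]
    refine ⟨?_, hyz⟩
    -- Otherwise `c` could be matched to `s(y, z)`, and the matching would not be maximal.
    by_contra hno
    have hcongr : ∀ d ∈ F, Function.update p c s(y, z) d = p d := fun d hd =>
      Function.update_of_ne (by rintro rfl; exact hcF hd) _ _
    have := hmax (insert c F) (mem_filter.2 ⟨mem_powerset.2 (insert_subset hcE hFE),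
      Function.update p c s(y, z), ?_, ?_, ?_⟩)
    · rw [card_insert_of_notMem hcF] at this
      omega
    · intro d hd w hw
      rcases mem_insert.1 hd with rfl | hd
      · rw [Function.update_self, Sym2.mem_iff] at hw
        rcases hw with rfl | rfl
        exacts [(hT d hcE).1 hy, (hT d hcE).1 hz]
      · rw [hcongr d hd] at hw
        exact hp d hd w hw
    · intro d hd
      rcases mem_insert.1 hd with rfl | hd
      · rw [Function.update_self, Sym2.mk_isDiag_iff]
        exact hyz
      · rw [hcongr d hd]
        exact hpd d hd
    · rw [coe_insert, Set.injOn_insert (by exact_mod_cast hcF)]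
      refine ⟨fun d hd d' hd' h => ?_, ?_⟩
      · rw [hcongr d hd, hcongr d' hd'] at h
        exact hpi hd hd' h
      · rintro ⟨d, hd, hdc⟩
        rw [hcongr d hd, Function.update_self] at hdc
        exact hno ⟨d, hd, hdc⟩

end Bipartite

/-! ### Chopping along distance levels -/

section Levels

variable {V : Type*} {G : SimpleGraph V}

/-- Some walk of `G` from `x` to `y` has length at most `m` and all its vertices in `S`. -/
def NearIn (G : SimpleGraph V) (S : Set V) (m : ℕ) (x y : V) : Prop :=
  ∃ p : G.Walk x y, p.length ≤ m ∧ ∀ z ∈ p.support, z ∈ S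

theorem NearIn.refl {S : Set V} {x : V} (hx : x ∈ S) (m : ℕ) : G.NearIn S m x x :=
  ⟨.nil, by simp, by simpa using hx⟩

theorem NearIn.symm {S : Set V} {m : ℕ} {x y : V} (h : G.NearIn S m x y) : G.NearIn S m y x := by
  obtain ⟨p, hm, hp⟩ := h
  exact ⟨p.reverse, by simpa using hm, by simpa using hp⟩

theorem NearIn.trans {S : Set V} {m n : ℕ} {x y z : V} (h : G.NearIn S m x y)
    (h' : G.NearIn S n y z) : G.NearIn S (m + n) x z := by
  obtain ⟨p, hm, hp⟩ := h
  obtain ⟨q, hn, hq⟩ := h'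
  refine ⟨p.append q, by rw [Walk.length_append]; omega, fun w hw => ?_⟩
  rcases (Walk.mem_support_append_iff _ _).1 hw with h | h
  exacts [hp _ h, hq _ h]

theorem NearIn.mono {S T : Set V} (hST : S ⊆ T) {m n : ℕ} (hmn : m ≤ n) {x y : V}
    (h : G.NearIn S m x y) : G.NearIn T n x y := by
  obtain ⟨p, hm, hp⟩ := h
  exact ⟨p, hm.trans hmn, fun z hz => hST (hp z hz)⟩

theorem NearIn.of_adj {S : Set V} {x y : V} (h : G.Adj x y) (hx : x ∈ S) (hy : y ∈ S) :
    G.NearIn S 1 x y :=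
  ⟨h.toWalk, by simp, by simp [hx, hy]⟩

theorem NearIn.linkedIn {S : Set V} {m : ℕ} {x y : V} (h : G.NearIn S m x y) :
    G.LinkedIn S x y := by
  obtain ⟨p, -, hp⟩ := h
  exact ⟨p, hp⟩

theorem LinkedIn.exists_nearIn {S : Set V} {x y : V} (h : G.LinkedIn S x y) :
    ∃ m, G.NearIn S m x y := by
  obtain ⟨p, hp⟩ := h
  exact ⟨p.length, p, le_rfl, hp⟩

/-- A walk inside `S` stays in the component of its first vertex. -/
theorem LinkedIn.linkedIn_component {S : Set V} {x y : V} (h : G.LinkedIn S x y) :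
    G.LinkedIn {v | v ∈ S ∧ G.LinkedIn S x v} x y := by
  classical
  obtain ⟨p, hp⟩ := h
  exact ⟨p, fun z hz => ⟨hp z hz, p.takeUntil z hz,
    fun w hw => hp w (p.support_takeUntil_subset_support hz hw)⟩⟩

theorem NearIn.nearIn_component {S : Set V} {m : ℕ} {x y : V} (h : G.NearIn S m x y) :
    G.NearIn {v | G.LinkedIn S x v} m x y := by
  classical
  obtain ⟨p, hm, hp⟩ := h
  exact ⟨p, hm, fun z hz => ⟨p.takeUntil z hz,
    fun w hw => hp w (p.support_takeUntil_subset_support hz hw)⟩⟩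

/-- `lvl` behaves like the distance, in the subgraph induced on `W`, to a root chosen in each of its
components. -/
structure IsLevelFunction (G : SimpleGraph V) (W : Set V) (lvl : V → ℕ) : Prop where
  le_succ : ∀ x ∈ W, ∀ y ∈ W, G.Adj x y → lvl y ≤ lvl x + 1
  exists_parent : ∀ y ∈ W, lvl y ≠ 0 → ∃ z ∈ W, G.Adj y z ∧ lvl z + 1 = lvl y
  eq_of_eq_zero : ∀ x y, G.LinkedIn W x y → lvl x = 0 → lvl y = 0 → x = y

theorem exists_isLevelFunction (G : SimpleGraph V) (W : Set V) :
    ∃ lvl, G.IsLevelFunction W lvl := by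
  classical
  let R : V → V := fun x => if h : {y | G.LinkedIn W x y}.Nonempty then h.some else x
  have hR : ∀ x ∈ W, G.LinkedIn W x (R x) := fun x hx => by
    have h : {y | G.LinkedIn W x y}.Nonempty := ⟨x, .refl hx⟩
    simp only [R, dif_pos h]
    exact h.some_mem
  have hRR : ∀ x y, G.LinkedIn W x y → R x = R y := fun x y hxy => by
    have h : {z | G.LinkedIn W x z} = {z | G.LinkedIn W y z} := by
      ext z
      exact ⟨fun h => hxy.symm.trans h, fun h => hxy.trans h⟩
    have hx : {z | G.LinkedIn W x z}.Nonempty := ⟨y, hxy⟩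
    have hy : {z | G.LinkedIn W y z}.Nonempty := ⟨x, hxy.symm⟩
    simp only [R, dif_pos hx, dif_pos hy]
    congr 1
  let lvl : V → ℕ := fun x => sInf {m | G.NearIn W m x (R x)}
  have hlvl : ∀ x ∈ W, G.NearIn W (lvl x) x (R x) := fun x hx =>
    Nat.sInf_mem (s := {m | G.NearIn W m x (R x)}) (hR x hx).exists_nearIn
  have hle : ∀ x m, G.NearIn W m x (R x) → lvl x ≤ m := fun x m h => Nat.sInf_le h
  have hsucc : ∀ x ∈ W, ∀ y ∈ W, G.Adj x y → lvl y ≤ lvl x + 1 := by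
    intro x hx y hy hadj
    have h := (NearIn.of_adj hadj.symm hy hx).trans (hlvl x hx)
    rw [hRR x y (.of_adj hadj hx hy)] at h
    exact (hle _ _ h).trans (by omega)
  refine ⟨lvl, hsucc, fun y hy hy0 => ?_, fun x y hxy hx hy => ?_⟩
  · obtain ⟨p, hp, hpW⟩ := hlvl y hy
    generalize hr : R y = r at p
    cases p with
    | nil =>
      have := hle y 0 (by rw [hr]; exact .refl hy 0)
      omega
    | cons hadj q =>
      rename_i z
      have hqW : ∀ u ∈ q.support, u ∈ W := fun u hu => hpW u (by simp [hu])
      have hz : z ∈ W := hqW z q.start_mem_support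
      refine ⟨z, hz, hadj, ?_⟩
      have h1 : lvl z ≤ q.length := hle z _ ⟨q.copy rfl (by
        rw [← hRR y z (.of_adj hadj hy hz), hr]), by simp, by simpa using hqW⟩
      have h2 := hsucc z hz y hy hadj.symm
      rw [Walk.length_cons] at hp
      omega
  · have hx' := hlvl x hxy.left_mem
    have hy' := hlvl y hxy.right_mem
    rw [hx] at hx'
    rw [hy] at hy'
    obtain ⟨p, hp, -⟩ := hx'
    obtain ⟨q, hq, -⟩ := hy'
    rw [Walk.eq_of_length_eq_zero (Nat.le_zero.1 hp), Walk.eq_of_length_eq_zero (Nat.le_zero.1 hq)]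
    exact hRR x y hxy

theorem IsLevelFunction.le_add {W : Set V} {lvl : V → ℕ} (h : G.IsLevelFunction W lvl) {m : ℕ}
    {x y : V} (hxy : G.NearIn W m x y) : lvl y ≤ lvl x + m := by
  obtain ⟨p, hm, hp⟩ := hxy
  induction p generalizing m with
  | nil => omega
  | cons hadj p ih =>
    have hp' : ∀ z ∈ p.support, z ∈ W := fun z hz => hp z (by simp [hz])
    rw [Walk.length_cons] at hm
    have h1 := ih (m := m - 1) (by omega) hp'
    have h2 := h.le_succ _ (hp _ (by simp)) _ (hp' _ p.start_mem_support) hadj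
    omega

/-- A chain of parents that descends from `x` to level zero. -/
theorem IsLevelFunction.exists_chain {W : Set V} {lvl : V → ℕ} (h : G.IsLevelFunction W lvl)
    {x : V} (hx : x ∈ W) : ∃ y : ℕ → V, y 0 = x ∧ (∀ m ≤ lvl x, y m ∈ W ∧ lvl (y m) = lvl x - m) ∧
      ∀ m < lvl x, G.Adj (y m) (y (m + 1)) := by
  have hpar : ∀ v, ∃ z, v ∈ W → lvl v ≠ 0 → z ∈ W ∧ G.Adj v z ∧ lvl z + 1 = lvl v := fun v => by
    by_cases hv : v ∈ W ∧ lvl v ≠ 0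
    · obtain ⟨z, hz⟩ := h.exists_parent v hv.1 hv.2
      exact ⟨z, fun _ _ => hz⟩
    · exact ⟨v, fun h1 h2 => absurd ⟨h1, h2⟩ hv⟩
  choose f hf using hpar
  have h1 : ∀ m ≤ lvl x, f^[m] x ∈ W ∧ lvl (f^[m] x) = lvl x - m := by
    intro m
    induction m with
    | zero => exact fun _ => ⟨hx, rfl⟩
    | succ m ih =>
      intro hm
      obtain ⟨h1, h2⟩ := ih (by omega)
      obtain ⟨h3, -, h4⟩ := hf _ h1 (by omega)
      rw [Function.iterate_succ_apply']
      exact ⟨h3, by omega⟩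
  refine ⟨fun m => f^[m] x, rfl, h1, fun m hm => ?_⟩
  obtain ⟨h2, h3⟩ := h1 m hm.le
  beta_reduce
  rw [Function.iterate_succ_apply']
  exact (hf _ h2 (by omega)).2.1

theorem nearIn_of_chain {y : ℕ → V} {S : Set V} {n : ℕ} (hS : ∀ m ≤ n, y m ∈ S)
    (hy : ∀ m < n, G.Adj (y m) (y (m + 1))) : ∀ m ≤ n, G.NearIn S m (y 0) (y m) := by
  intro m
  induction m with
  | zero => exact fun h => .refl (hS 0 h) 0
  | succ m ih => exact fun h => (ih (by omega)).trans (.of_adj (hy m h) (hS _ (by omega)) (hS _ h))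

open Finset in
open scoped Classical in
/-- Deleting every `Δ`-th level of the subgraph induced on `W` costs at most a fraction `1 / Δ` of
the vertices, and confines every remaining component to fewer than `Δ` consecutive levels. -/
theorem exists_chop (G : SimpleGraph V) (W : Finset V) {Δ : ℕ} (hΔ : 0 < Δ) :
    ∃ W' ⊆ W, Δ * #(W \ W') ≤ #W ∧ ∃ lvl, G.IsLevelFunction (W : Set V) lvl ∧
      ∀ x ∈ W', ∃ a b, b ≤ a + Δ ∧ (∀ y, G.LinkedIn (W' : Set V) x y → a ≤ lvl y ∧ lvl y ≤ b) ∧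
        ∀ z ∈ W, a ≤ lvl z → lvl z ≤ b → z ∈ W' := by
  obtain ⟨lvl, hlvl⟩ := G.exists_isLevelFunction (W : Set V)
  obtain ⟨i, hi⟩ : ∃ i, Δ * #{x ∈ W | Δ ∣ lvl x + i} ≤ #W := by
    have h1 : ∑ i ∈ range Δ, #{x ∈ W | Δ ∣ lvl x + i} ≤ #W := by
      have h2 := sum_card_bipartiteAbove_eq_sum_card_bipartiteBelow
        (s := range Δ) (t := W) (fun i x => Δ ∣ lvl x + i)
      simp only [bipartiteAbove, bipartiteBelow] at h2
      rw [h2, card_eq_sum_ones]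
      refine sum_le_sum fun x _ => card_le_one.2 fun i hi j hj => ?_
      obtain ⟨hi, hi'⟩ := mem_filter.1 hi
      obtain ⟨hj, hj'⟩ := mem_filter.1 hj
      rw [mem_range] at hi hj
      have : i ≡ j [MOD Δ] := Nat.ModEq.add_left_cancel' (lvl x)
        (((Nat.modEq_zero_iff_dvd).2 hi').trans ((Nat.modEq_zero_iff_dvd).2 hj').symm)
      exact this.eq_of_lt_of_lt hi hj
    by_contra! h
    have h2 : ∑ i ∈ range Δ, #W < ∑ i ∈ range Δ, Δ * #{x ∈ W | Δ ∣ lvl x + i} :=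
      sum_lt_sum_of_nonempty ⟨0, mem_range.2 hΔ⟩ fun i _ => h i
    rw [sum_const, card_range, smul_eq_mul, ← mul_sum] at h2
    exact absurd (Nat.mul_le_mul_left Δ h1) (by omega)
  refine ⟨{x ∈ W | ¬ Δ ∣ lvl x + i}, filter_subset _ _, ?_, lvl, hlvl, fun x hx => ?_⟩
  · convert hi using 3
    ext x
    simp only [mem_sdiff, mem_filter]
    tauto
  · have hq : ∀ y, G.LinkedIn (({x ∈ W | ¬ Δ ∣ lvl x + i} : Finset V) : Set V) x y →
        (lvl x + i) / Δ = (lvl y + i) / Δ := fun y hxy => by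
      refine hxy.lift (r := fun x y => (lvl x + i) / Δ = (lvl y + i) / Δ) (fun _ _ => rfl)
        (fun _ _ _ h h' => h.trans h') fun u hu v hv huv => ?_
      obtain ⟨hu, hu'⟩ := mem_filter.1 (mem_coe.1 hu)
      obtain ⟨hv, hv'⟩ := mem_filter.1 (mem_coe.1 hv)
      have h1 := hlvl.le_succ u hu v hv huv
      have h2 := hlvl.le_succ v hv u hu huv.symm
      rcases lt_trichotomy (lvl u) (lvl v) with h | h | h
      · have h3 : lvl v + i = lvl u + i + 1 := by omega
        rw [h3] at hv' ⊢
        rw [Nat.succ_div, if_neg hv', add_zero]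
      · rw [h]
      · have h3 : lvl u + i = lvl v + i + 1 := by omega
        rw [h3] at hu' ⊢
        rw [Nat.succ_div, if_neg hu', add_zero]
    set q := (lvl x + i) / Δ with hqdef
    have hqy : ∀ y, G.LinkedIn (({x ∈ W | ¬ Δ ∣ lvl x + i} : Finset V) : Set V) x y →
        q * Δ < lvl y + i ∧ lvl y + i < q * Δ + Δ := fun y hxy => by
      have h1 : ¬ Δ ∣ lvl y + i := (mem_filter.1 (mem_coe.1 hxy.right_mem)).2
      have h2 := Nat.div_add_mod (lvl y + i) Δ
      have h3 := Nat.mod_lt (lvl y + i) hΔ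
      have h4 : (lvl y + i) % Δ ≠ 0 := fun h => h1 (Nat.dvd_of_mod_eq_zero h)
      rw [← hq y hxy, mul_comm] at h2
      omega
    have hqx := hqy x (.refl (mem_coe.2 hx))
    refine ⟨q * Δ + 1 - i, q * Δ + Δ - 1 - i, by omega, fun y hxy => ?_, fun z hz h1 h2 => ?_⟩
    · have := hqy y hxy
      omega
    · refine mem_filter.2 ⟨hz, fun hd => ?_⟩
      have h3 : q * Δ < lvl z + i := by omega
      have h4 : lvl z + i < (q + 1) * Δ := by rw [add_mul, one_mul]; omega
      obtain ⟨r, hr⟩ := hd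
      rw [hr, mul_comm Δ] at h3 h4
      have h5 := lt_of_mul_lt_mul_right h3 (Nat.zero_le _)
      have h6 := lt_of_mul_lt_mul_right h4 (Nat.zero_le _)
      omega

/-- Inside `T`, there are `n` disjoint connected sets `A i` and three connected sets `B j`, disjoint
from the sets `A i` and joined to each of them by an edge. The set `B j` lies in the ball of radius
`R` about `x₀ j`, and contains a vertex at distance more than `Δ`, in `T`, from all sets `A i`. Two
sets `B j` are disjoint as soon as the three centres are far apart. -/
def HasTentacles (G : SimpleGraph V) (W₀ : Set V) (x₀ : Fin 3 → V) (Δ R n : ℕ) (T : Set V) : Prop :=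
  ∃ (x : Fin 3 → V) (B : Fin 3 → Set V) (A : Fin n → Set V),
    (∀ j, x j ∈ B j ∧ B j ⊆ T ∧ G.ConnectedOn (B j) ∧ ∀ y ∈ B j, G.NearIn W₀ R (x₀ j) y) ∧
    (∀ i, A i ⊆ T ∧ G.ConnectedOn (A i)) ∧ (∀ i i', i ≠ i' → Disjoint (A i) (A i')) ∧
    (∀ i j, Disjoint (A i) (B j) ∧ ∃ u ∈ A i, ∃ v ∈ B j, G.Adj u v) ∧
    ∀ i j, ∀ y ∈ A i, ¬ G.NearIn T Δ (x j) y

/-- Let `T'` be a component of what is left of the component `T` of `W` after a chopping. Its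
vertices have levels at least `a`. The set `B j` is extended by a chain of parents that starts at
`x j`. The part of the chain in `T'` is so short that it misses the old sets `A i`, and the rest of
it lies outside `T'`. The new set `A i` consists of the vertices of `T` at all levels less than `c`,
and the new vertex `x j` is the vertex of the chain half-way between the levels `c` and `a`. -/
theorem HasTentacles.succ {W₀ W W' : Set V} (hW₀ : W ⊆ W₀) (hW : W' ⊆ W) {x₀ : Fin 3 → V}
    {w : V} {Δ R n : ℕ} {lvl : V → ℕ} (hlvl : G.IsLevelFunction W lvl) {a b : ℕ} (hab : b ≤ a + Δ)
    (hblock : ∀ y, G.LinkedIn W' w y → a ≤ lvl y ∧ lvl y ≤ b)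
    (hmem : ∀ z ∈ W, a ≤ lvl z → lvl z ≤ b → z ∈ W')
    (hfar : ∀ i j, i ≠ j → ¬ G.NearIn W₀ (2 * (R + (3 * Δ + 3))) (x₀ i) (x₀ j))
    (h : G.HasTentacles W₀ x₀ Δ R n {y | G.LinkedIn W' w y}) :
    G.HasTentacles W₀ x₀ Δ (R + (3 * Δ + 3)) (n + 1) {y | G.LinkedIn W w y} := by
  obtain ⟨x, B, A, hB, hA, hAA, hAB, hAx⟩ := h
  set T' : Set V := {y | G.LinkedIn W' w y} with hT'
  set T : Set V := {y | G.LinkedIn W w y} with hT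
  have hTT : T' ⊆ T := fun y hy => LinkedIn.mono hW hy
  have hTW : T ⊆ W := fun y hy => LinkedIn.right_mem hy
  have hxT' : ∀ j, x j ∈ T' := fun j => (hB j).2.1 (hB j).1
  have hxW : ∀ j, x j ∈ W := fun j => hTW (hTT (hxT' j))
  choose y hy0 hyW hyadj using fun j => hlvl.exists_chain (hxW j)
  have hya : ∀ j, a ≤ lvl (x j) ∧ lvl (x j) ≤ b := fun j => hblock _ (hxT' j)
  have hyT : ∀ j, ∀ m ≤ lvl (x j), y j m ∈ T := fun j m hm => by
    have h1 := (nearIn_of_chain (fun m hm => (hyW j m hm).1) (hyadj j) m hm).linkedIn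
    rw [hy0] at h1
    exact LinkedIn.trans (hTT (hxT' j)) h1
  have hnear : ∀ j, ∀ m ≤ lvl (x j), G.NearIn W₀ (R + m) (x₀ j) (y j m) := fun j m hm => by
    have h1 := nearIn_of_chain (fun m hm => (hyW j m hm).1) (hyadj j) m hm
    rw [hy0] at h1
    exact ((hB j).2.2.2 _ (hB j).1).trans (h1.mono hW₀ le_rfl)
  have hroot : ∀ i j, y i (lvl (x i)) = y j (lvl (x j)) := fun i j => by
    have hl : ∀ i, lvl (y i (lvl (x i))) = 0 := fun i => by
      rw [(hyW i _ le_rfl).2, Nat.sub_self]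
    exact hlvl.eq_of_eq_zero _ _
      ((LinkedIn.symm (hyT i _ le_rfl)).trans (hyT j _ le_rfl)) (hl i) (hl j)
  -- Otherwise `x₀ 0` and `x₀ 1` would both be close to the root of `T`.
  have ha : 2 * Δ + 3 ≤ a := by
    by_contra! hlt
    refine hfar 0 1 (by decide) ?_
    have h0 := hnear 0 _ le_rfl
    have h1 := hnear 1 _ le_rfl
    rw [hroot 1 0] at h1
    refine (h0.trans h1.symm).mono subset_rfl ?_
    have := hya 0
    have := hya 1
    omega
  obtain ⟨c, hc⟩ : ∃ c, a = c + (2 * Δ + 2) := ⟨a - (2 * Δ + 2), by omega⟩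
  let S : Fin 3 → Set V := fun j => {u | ∃ m ≤ lvl (x j) - c, u = y j m}
  have hSconn : ∀ j, G.ConnectedOn (S j) := fun j => by
    refine .of_center (x := y j 0) ⟨0, Nat.zero_le _, rfl⟩ ?_
    rintro u ⟨m, hm, rfl⟩
    exact (nearIn_of_chain (S := S j) (n := lvl (x j) - c) (fun m hm => ⟨m, hm, rfl⟩)
      (fun m hm => hyadj j m (by omega)) m hm).linkedIn
  have hSlvl : ∀ j, ∀ u ∈ S j, c ≤ lvl u := by
    rintro j u ⟨m, hm, rfl⟩
    have := hya j
    rw [(hyW j m (by omega)).2]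
    omega
  have hST : ∀ j, S j ⊆ T := by
    rintro j u ⟨m, hm, rfl⟩
    exact hyT j m (by omega)
  -- The part of a chain in the block of `T'` is a path of length at most `Δ` in `T'`.
  have hSA : ∀ i j, Disjoint (A i) (S j) := by
    intro i j
    rw [Set.disjoint_left]
    rintro u hu ⟨m, hm, rfl⟩
    have hau := (hblock _ ((hA i).1 hu)).1
    have hj := hya j
    have hm' : m ≤ lvl (x j) := by omega
    rw [(hyW j m hm').2] at hau
    have h1 := nearIn_of_chain (S := W') (y := y j) (n := m) (fun l hl => by
      obtain ⟨h1, h2⟩ := hyW j l (by omega)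
      exact hmem _ h1 (by omega) (by omega)) (fun l hl => hyadj j l (by omega)) m le_rfl
    rw [hy0] at h1
    refine hAx i j _ hu (h1.nearIn_component.mono (fun v hv => ?_) (by omega))
    exact LinkedIn.trans (hxT' j) hv
  let A₀ : Set V := {u | u ∈ T ∧ lvl u < c}
  have hA₀conn : G.ConnectedOn A₀ := by
    have hr : y 0 (lvl (x 0)) ∈ T := hyT 0 _ le_rfl
    have hr0 : lvl (y 0 (lvl (x 0))) = 0 := by rw [(hyW 0 _ le_rfl).2, Nat.sub_self]
    have hc0 : 0 < c := by omega
    refine .of_center (x := y 0 (lvl (x 0))) (S := A₀) ⟨hr, by rwa [hr0]⟩ ?_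
    rintro u ⟨huT, huc⟩
    obtain ⟨z, hz0, hzW, hzadj⟩ := hlvl.exists_chain (hTW huT)
    have h1 := (nearIn_of_chain (S := {v | v ∈ W ∧ lvl v < c}) (y := z) (fun m hm => by
      obtain ⟨h1, h2⟩ := hzW m hm
      exact ⟨h1, by omega⟩) hzadj _ le_rfl).linkedIn
    rw [hz0] at h1
    have h2 : z (lvl u) = y 0 (lvl (x 0)) := by
      refine hlvl.eq_of_eq_zero _ _ ?_ (by rw [(hzW _ le_rfl).2, Nat.sub_self]) hr0
      exact (h1.mono fun v hv => hv.1).symm.trans ((LinkedIn.symm huT).trans hr)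
    rw [h2] at h1
    refine LinkedIn.symm (LinkedIn.mono (T := A₀) (fun v hv => ⟨?_, hv.1.2⟩) h1.linkedIn_component)
    exact LinkedIn.trans huT (hv.2.mono fun v hv => hv.1)
  have hAlvl : ∀ i, ∀ u ∈ A i, a ≤ lvl u := fun i u hu => (hblock _ ((hA i).1 hu)).1
  refine ⟨fun j => y j (lvl (x j) - (c + Δ + 1)), fun j => B j ∪ S j, Fin.cons A₀ A,
    fun j => ⟨?_, ?_, ?_, ?_⟩, fun i => ?_, fun i i' hii => ?_, fun i j => ?_,
    fun i j u hu hn => ?_⟩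
  · exact Or.inr ⟨_, by omega, rfl⟩
  · exact Set.union_subset ((hB j).2.1.trans hTT) (hST j)
  · exact (hB j).2.2.1.union_of_mem (hSconn j) (hB j).1 ⟨0, Nat.zero_le _, (hy0 j).symm⟩
  · rintro u (hu | ⟨m, hm, rfl⟩)
    · exact ((hB j).2.2.2 u hu).mono subset_rfl (by omega)
    · have := hya j
      exact (hnear j m (by omega)).mono subset_rfl (by omega)
  · cases i using Fin.cases with
    | zero => exact ⟨fun u hu => hu.1, hA₀conn⟩
    | succ i => exact ⟨(hA i).1.trans hTT, (hA i).2⟩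
  · have hd : ∀ i, Disjoint A₀ (A i) := fun i => by
      rw [Set.disjoint_left]
      intro u hu hu'
      have := hAlvl i u hu'
      have := hu.2
      omega
    cases i using Fin.cases with
    | zero =>
      cases i' using Fin.cases with
      | zero => exact absurd rfl hii
      | succ i' => exact hd i'
    | succ i =>
      cases i' using Fin.cases with
      | zero => exact (hd i).symm
      | succ i' => exact hAA i i' fun h => hii (h ▸ rfl)
  · have hj := hya j
    cases i using Fin.cases with
    | zero =>
      refine ⟨?_, y j (lvl (x j) - c + 1), ⟨hyT j _ (by omega), ?_⟩, y j (lvl (x j) - c),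
        Or.inr ⟨_, le_rfl, rfl⟩, (hyadj j _ (by omega)).symm⟩
      · rw [Set.disjoint_left]
        rintro u hu (hu' | hu')
        · have := (hblock _ ((hB j).2.1 hu')).1
          have := hu.2
          omega
        · have := hSlvl j u hu'
          have := hu.2
          omega
      · rw [(hyW j _ (by omega)).2]
        omega
    | succ i =>
      obtain ⟨h1, u, hu, v, hv, huv⟩ := hAB i j
      exact ⟨Set.disjoint_union_right.2 ⟨h1, hSA i j⟩, u, hu, v, Or.inl hv, huv⟩
  · have hj := hya j
    have h1 := hlvl.le_add (hn.mono hTW le_rfl)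
    have h2 := hlvl.le_add (hn.mono hTW le_rfl).symm
    rw [(hyW j _ (by omega)).2] at h1 h2
    cases i using Fin.cases with
    | zero =>
      have : lvl u < c := hu.2
      omega
    | succ i =>
      have := hAlvl i u hu
      omega

open Finset in
open scoped Classical in
/-- After three rounds of chopping, no component contains three vertices that are pairwise far
apart. -/
theorem K33MinorFree.exists_chop (hG : G.K33MinorFree) (W₀ : Finset V) {Δ : ℕ} (hΔ : 0 < Δ) :
    ∃ W ⊆ W₀, Δ * #(W₀ \ W) ≤ 3 * #W₀ ∧ ∀ x : Fin 3 → V,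
      (∀ i j, G.LinkedIn (W : Set V) (x i) (x j)) →
      ∃ i j, i ≠ j ∧ G.NearIn (W₀ : Set V) (18 * Δ + 18) (x i) (x j) := by
  obtain ⟨W₁, h₁, hc₁, l₁, hl₁, hb₁⟩ := G.exists_chop W₀ hΔ
  obtain ⟨W₂, h₂, hc₂, l₂, hl₂, hb₂⟩ := G.exists_chop W₁ hΔ
  obtain ⟨W₃, h₃, hc₃, l₃, hl₃, hb₃⟩ := G.exists_chop W₂ hΔ
  refine ⟨W₃, h₃.trans (h₂.trans h₁), ?_, fun x hx => ?_⟩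
  · have e₁ := card_sdiff_add_card_eq_card h₁
    have e₂ := card_sdiff_add_card_eq_card h₂
    have e₃ := card_sdiff_add_card_eq_card h₃
    have e := card_sdiff_add_card_eq_card (h₃.trans (h₂.trans h₁))
    have : #(W₀ \ W₃) = #(W₀ \ W₁) + #(W₁ \ W₂) + #(W₂ \ W₃) := by omega
    rw [this, mul_add, mul_add]
    omega
  · by_contra! hfar
    have hx₃ : x 0 ∈ W₃ := (hx 0 0).left_mem
    have s₃ : G.HasTentacles (W₀ : Set V) x Δ 0 0 {y | G.LinkedIn (W₃ : Set V) (x 0) y} := by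
      refine ⟨x, fun j => {x j}, Fin.elim0, fun j => ⟨rfl, ?_, .singleton _, ?_⟩, fun i => i.elim0,
        fun i => i.elim0, fun i => i.elim0, fun i => i.elim0⟩
      · rintro y rfl
        exact hx 0 j
      · rintro y rfl
        exact .refl (h₁ (h₂ (h₃ (hx j j).left_mem))) 0
    have hfar' : ∀ m ≤ 18 * Δ + 18, ∀ i j, i ≠ j → ¬ G.NearIn (W₀ : Set V) m (x i) (x j) :=
      fun m hm i j hij h => hfar i j hij (h.mono subset_rfl hm)
    obtain ⟨a₃, b₃, hab₃, hy₃, hz₃⟩ := hb₃ (x 0) hx₃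
    obtain ⟨a₂, b₂, hab₂, hy₂, hz₂⟩ := hb₂ (x 0) (h₃ hx₃)
    obtain ⟨a₁, b₁, hab₁, hy₁, hz₁⟩ := hb₁ (x 0) (h₂ (h₃ hx₃))
    have s₂ := s₃.succ (coe_subset.2 (h₂.trans h₁)) (coe_subset.2 h₃) hl₃ hab₃ hy₃ hz₃
      (hfar' _ (by omega))
    have s₁ := s₂.succ (coe_subset.2 h₁) (coe_subset.2 h₂) hl₂ hab₂ hy₂ hz₂ (hfar' _ (by omega))
    obtain ⟨y, B, A, hB, hA, hAA, hAB, -⟩ := s₁.succ subset_rfl (coe_subset.2 h₁) hl₁ hab₁ hy₁ hz₁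
      (hfar' _ (by omega))
    refine hG.false_of_sets (fun i => (hA i).2) (fun j => (hB j).2.2.1) hAA (fun i j hij => ?_)
      (fun i j => (hAB i j).1) (fun i j => (hAB i j).2)
    rw [Set.disjoint_left]
    intro u hu hu'
    exact hfar' _ (by omega) i j hij (((hB i).2.2.2 u hu).trans ((hB j).2.2.2 u hu').symm)

end Levels

/-! ### Sizes of balls and components -/

section Balls

open Finset
open scoped Classical

variable {V : Type*} [Fintype V] {G : SimpleGraph V}

theorem card_nearIn_le {W : Set V} {D : ℕ} (hD : ∀ x ∈ W, #{y | y ∈ W ∧ G.Adj x y} ≤ D) (m : ℕ) :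
    ∀ x, #{y | G.NearIn W m x y} ≤ (D + 1) ^ m := by
  induction m with
  | zero =>
    intro x
    refine card_le_one.2 fun y hy z hz => ?_
    obtain ⟨p, hp, -⟩ := (mem_filter.1 hy).2
    obtain ⟨q, hq, -⟩ := (mem_filter.1 hz).2
    rw [← Walk.eq_of_length_eq_zero (Nat.le_zero.1 hp),
      ← Walk.eq_of_length_eq_zero (Nat.le_zero.1 hq)]
  | succ m ih =>
    intro x
    by_cases hx : x ∈ W
    · have hsub : ({y | G.NearIn W (m + 1) x y} : Finset V) ⊆
          {x} ∪ ({y | y ∈ W ∧ G.Adj x y} : Finset V).biUnion fun z => {y | G.NearIn W m z y} := by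
        intro y hy
        obtain ⟨p, hp, hpW⟩ := (mem_filter.1 hy).2
        cases p with
        | nil => exact mem_union_left _ (mem_singleton_self _)
        | cons hadj q =>
          have hqW : ∀ u ∈ q.support, u ∈ W := fun u hu => hpW u (by simp [hu])
          rw [Walk.length_cons] at hp
          exact mem_union_right _ (mem_biUnion.2 ⟨_, mem_filter.2 ⟨mem_univ _,
            hqW _ q.start_mem_support, hadj⟩, mem_filter.2 ⟨mem_univ _, q, by omega, hqW⟩⟩)
      have h1 := card_biUnion_le_card_mul ({y | y ∈ W ∧ G.Adj x y} : Finset V)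
        (fun z => ({y | G.NearIn W m z y} : Finset V)) _ fun z _ => ih z
      have h2 := (card_le_card hsub).trans (card_union_le _ _)
      have h3 : 1 ≤ (D + 1) ^ m := Nat.one_le_pow _ _ (by omega)
      have h4 := Nat.mul_le_mul_right ((D + 1) ^ m) (hD x hx)
      rw [card_singleton] at h2
      rw [pow_succ]
      nlinarith
    · rw [filter_false_of_mem]
      · simp
      · exact fun y _ h => hx h.linkedIn.left_mem

/-- Outside a small set, a graph without a `K₃,₃` minor in which the degrees are bounded falls apart
into components of bounded size. -/
theorem K33MinorFree.exists_small_components (hG : G.K33MinorFree) {W₀ : Finset V} {Δ D : ℕ}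
    (hΔ : 0 < Δ) (hD : ∀ x ∈ W₀, #{y | G.Adj x y} ≤ D) :
    ∃ W ⊆ W₀, Δ * #(W₀ \ W) ≤ 3 * #W₀ ∧
      ∀ x, #{y | G.LinkedIn (W : Set V) x y} ≤ 2 * (D + 1) ^ (18 * Δ + 18) := by
  obtain ⟨W, hW, hcard, hfar⟩ := hG.exists_chop W₀ hΔ
  refine ⟨W, hW, hcard, fun x => ?_⟩
  have hball := card_nearIn_le (G := G) (W := (W₀ : Set V)) (D := D)
    (fun x hx => (card_le_card fun y hy => by
      simp only [mem_filter, mem_univ, true_and] at hy ⊢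
      exact hy.2).trans (hD x hx)) (18 * Δ + 18)
  by_cases h : ∃ y, G.LinkedIn (W : Set V) x y ∧ ¬ G.NearIn (W₀ : Set V) (18 * Δ + 18) x y
  · obtain ⟨y, hxy, hny⟩ := h
    have hsub : ({z | G.LinkedIn (W : Set V) x z} : Finset V) ⊆
        ({z | G.NearIn (W₀ : Set V) (18 * Δ + 18) x z} : Finset V) ∪
          ({z | G.NearIn (W₀ : Set V) (18 * Δ + 18) y z} : Finset V) := by
      intro z hz
      have hz := (mem_filter.1 hz).2
      have hall : ∀ i, G.LinkedIn (W : Set V) x (![x, y, z] i) := by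
        intro i
        fin_cases i
        exacts [.refl hxy.left_mem, hxy, hz]
      obtain ⟨i, j, hij, hn⟩ := hfar ![x, y, z] fun i j => (hall i).symm.trans (hall j)
      simp only [mem_union, mem_filter, mem_univ, true_and]
      fin_cases i <;> fin_cases j <;> simp at hij hn
      · exact absurd hn hny
      · exact Or.inl hn
      · exact absurd hn.symm hny
      · exact Or.inr hn
      · exact Or.inl hn.symm
      · exact Or.inr hn.symm
    have h1 := (card_le_card hsub).trans (card_union_le _ _)
    have h2 := hball x
    have h3 := hball y
    omega
  · push Not at h
    have h1 : #{y | G.LinkedIn (W : Set V) x y} ≤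
        #{y | G.NearIn (W₀ : Set V) (18 * Δ + 18) x y} :=
      card_le_card fun y hy => mem_filter.2 ⟨mem_univ _, h y (mem_filter.1 hy).2⟩
    have h2 := hball x
    omega

end Balls

end SimpleGraph

section AdditionalEdge

open unitInterval

/-! ### Drawing an additional edge along a path -/

theorem Path.trans_injective {X : Type*} [TopologicalSpace X] {a b c : X} {γ : Path a b}
    {γ' : Path b c} (h : Function.Injective γ) (h' : Function.Injective γ')
    (hd : ∀ s t, γ s = γ' t → t = 0) : Function.Injective (γ.trans γ') := by
  have mixed : ∀ s t : I, (s : ℝ) ≤ 1 / 2 → ¬ (t : ℝ) ≤ 1 / 2 →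
      γ.trans γ' s ≠ γ.trans γ' t := by
    intro s t hs ht hst
    rw [Path.trans_apply, Path.trans_apply, dif_pos hs, dif_neg ht] at hst
    have := congrArg Subtype.val (hd _ _ hst)
    simp only [Set.Icc.coe_zero] at this
    linarith
  intro s t hst
  by_cases hs : (s : ℝ) ≤ 1 / 2 <;> by_cases ht : (t : ℝ) ≤ 1 / 2
  · rw [Path.trans_apply, Path.trans_apply, dif_pos hs, dif_pos ht] at hst
    have := congrArg Subtype.val (h hst)
    simp only at this
    exact Subtype.ext (by linarith)
  · exact absurd hst (mixed s t hs ht)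
  · exact absurd hst.symm (mixed t s ht hs)
  · rw [Path.trans_apply, Path.trans_apply, dif_neg hs, dif_neg ht] at hst
    have := congrArg Subtype.val (h' hst)
    simp only at this
    exact Subtype.ext (by linarith)

namespace SimpleGraph

variable {V : Type*} {G : SimpleGraph V}

namespace PlaneDrawing

/-- The part of the plane covered by the drawing of a walk. -/
def walkTrace (D : PlaneDrawing G) {u v : V} (p : G.Walk u v) : Set (EuclideanSpace ℝ (Fin 2)) :=
  {z | (∃ x ∈ p.support, z = D.point x) ∨
    ∃ e : G.edgeSet, e.1 ∈ p.edges ∧ ∃ t : I, 0 < t ∧ t < 1 ∧ z = D.arc e t}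

theorem exists_path_of_adj (D : PlaneDrawing G) {x y : V} (h : G.Adj x y) :
    ∃ η : _root_.Path (D.point x) (D.point y), Function.Injective η ∧
      ∀ t, t ≠ 0 → t ≠ 1 → ∃ t', 0 < t' ∧ t' < 1 ∧ η t = D.arc ⟨s(x, y), h⟩ t' := by
  let e : G.edgeSet := ⟨s(x, y), h⟩
  have hpos : ∀ t : I, t ≠ 0 → 0 < t := fun t => unitInterval.pos_iff_ne_zero.2
  have hlt : ∀ t : I, t ≠ 1 → t < 1 := fun t => unitInterval.lt_one_iff_ne_one.2
  have hends := D.arc_ends e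
  rw [Sym2.map_mk, Sym2.eq_iff] at hends
  rcases hends with ⟨h0, h1⟩ | ⟨h0, h1⟩
  · exact ⟨⟨⟨D.arc e, D.arc_continuous e⟩, h0, h1⟩, D.arc_injective e,
      fun t ht0 ht1 => ⟨t, hpos t ht0, hlt t ht1, rfl⟩⟩
  · refine ⟨(⟨⟨D.arc e, D.arc_continuous e⟩, h0, h1⟩ : _root_.Path _ _).symm, fun s t hst =>
      unitInterval.symm_bijective.injective (D.arc_injective e hst), fun t ht0 ht1 => ?_⟩
    refine ⟨σ t, hpos _ fun h => ht1 ?_, hlt _ fun h => ht0 ?_, rfl⟩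
    · simpa using congrArg σ h
    · simpa using congrArg σ h

/-- A path of a plane graph is drawn as a simple arc. -/
theorem exists_path_of_isPath (D : PlaneDrawing G) {u v : V} (p : G.Walk u v) (hp : p.IsPath)
    (huv : u ≠ v) : ∃ γ : _root_.Path (D.point u) (D.point v), Function.Injective γ ∧
      ∀ t, γ t ∈ D.walkTrace p := by
  induction p with
  | nil => exact absurd rfl huv
  | @cons u w v hadj p ih =>
    obtain ⟨hp', hu⟩ := (Walk.cons_isPath_iff _ _).1 hp
    obtain ⟨η, hη, hηt⟩ := D.exists_path_of_adj hadj
    have hηmem : ∀ t, η t ∈ D.walkTrace (Walk.cons hadj p) := by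
      intro t
      by_cases ht0 : t = 0
      · exact Or.inl ⟨u, by simp, by rw [ht0, η.source]⟩
      by_cases ht1 : t = 1
      · exact Or.inl ⟨w, by simp, by rw [ht1, η.target]⟩
      obtain ⟨t', h0, h1, h⟩ := hηt t ht0 ht1
      exact Or.inr ⟨_, by simp, t', h0, h1, h⟩
    by_cases hwv : w = v
    · subst hwv
      exact ⟨η, hη, hηmem⟩
    obtain ⟨γ, hγ, hγt⟩ := ih hp' hwv
    refine ⟨η.trans γ, _root_.Path.trans_injective hη hγ fun s t hst => ?_, fun t => ?_⟩
    · by_cases hs1 : s = 1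
      · rw [hs1, η.target] at hst
        exact (hγ (γ.source.trans hst)).symm
      exfalso
      by_cases hs0 : s = 0
      · rw [hs0, η.source] at hst
        rcases hγt t with ⟨x, hx, h⟩ | ⟨e, he, t', h0, h1, h⟩
        · rw [← hst] at h
          exact hu (D.point_injective h ▸ hx)
        · rw [← hst] at h
          exact D.arc_ne_point e t' h0 h1 u h.symm
      · obtain ⟨s', hs0', hs1', hs⟩ := hηt s hs0 hs1
        rw [hs] at hst
        rcases hγt t with ⟨x, hx, h⟩ | ⟨e, he, t', h0, h1, h⟩
        · exact D.arc_ne_point _ s' hs0' hs1' x (hst.trans h)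
        · refine D.arc_ne_arc _ e ?_ s' t' hs0' hs1' h0 h1 (hst.trans h)
          rintro rfl
          exact hu (Walk.fst_mem_support_of_mem_edges _ he)
    · rw [Path.trans_apply]
      split_ifs
      · exact hηmem _
      · rcases hγt _ with ⟨x, hx, h⟩ | ⟨e, he, h⟩
        · exact Or.inl ⟨x, by simp [hx], h⟩
        · exact Or.inr ⟨e, by simp [he], h⟩

/-- A graph is planar if, apart from at most one edge `e₀`, it is embedded in a plane graph, and
`e₀` can be drawn as a simple arc `γ` that avoids the drawing of the rest. -/
theorem isPlanar_of_extra_arc (D : PlaneDrawing G) {V' : Type*} {G' : SimpleGraph V'} {f : V' → V}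
    (hf : Function.Injective f) (e₀ : Sym2 V') (γ : I → EuclideanSpace ℝ (Fin 2))
    (h : ∀ e ∈ G'.edgeSet, Sym2.map f e ∉ G.edgeSet → e = e₀ ∧ Continuous γ ∧
      Function.Injective γ ∧ s(γ 0, γ 1) = Sym2.map D.point (Sym2.map f e) ∧
      ∀ t, 0 < t → t < 1 → (∀ w, γ t ≠ D.point (f w)) ∧ ∀ e' : G.edgeSet,
        (∀ x ∈ e'.1, x ∈ Set.range f) → ∀ t', 0 < t' → t' < 1 → γ t ≠ D.arc e' t') :
    G'.IsPlanar := by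
  classical
  let arc : G'.edgeSet → I → EuclideanSpace ℝ (Fin 2) := fun e =>
    if he : Sym2.map f e.1 ∈ G.edgeSet then D.arc ⟨_, he⟩ else γ
  have harc : ∀ e : G'.edgeSet, ∀ he : Sym2.map f e.1 ∈ G.edgeSet, arc e = D.arc ⟨_, he⟩ :=
    fun e he => dif_pos he
  have harc' : ∀ e : G'.edgeSet, Sym2.map f e.1 ∉ G.edgeSet → arc e = γ := fun e he => dif_neg he
  have hrange : ∀ e : G'.edgeSet, ∀ x ∈ Sym2.map f e.1, x ∈ Set.range f := by
    intro e x hx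
    obtain ⟨y, -, hy⟩ := Sym2.mem_map.1 hx
    exact ⟨y, hy⟩
  refine ⟨⟨fun x => D.point (f x), D.point_injective.comp hf, arc, fun e => ?_, fun e => ?_,
    fun e => ?_, fun e t h0 h1 v => ?_, fun e e' hee t t' h0 h1 h0' h1' => ?_⟩⟩
  · by_cases he : Sym2.map f e.1 ∈ G.edgeSet
    · rw [harc e he]; exact D.arc_continuous _
    · rw [harc' e he]; exact (h e e.2 he).2.1
  · by_cases he : Sym2.map f e.1 ∈ G.edgeSet
    · rw [harc e he]; exact D.arc_injective _
    · rw [harc' e he]; exact (h e e.2 he).2.2.1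
  · by_cases he : Sym2.map f e.1 ∈ G.edgeSet
    · rw [harc e he, D.arc_ends, Sym2.map_map]; rfl
    · rw [harc' e he, (h e e.2 he).2.2.2.1, Sym2.map_map]; rfl
  · by_cases he : Sym2.map f e.1 ∈ G.edgeSet
    · rw [harc e he]; exact D.arc_ne_point _ t h0 h1 _
    · rw [harc' e he]; exact ((h e e.2 he).2.2.2.2 t h0 h1).1 v
  · by_cases he : Sym2.map f e.1 ∈ G.edgeSet <;> by_cases he' : Sym2.map f e'.1 ∈ G.edgeSet
    · rw [harc e he, harc e' he']
      refine D.arc_ne_arc _ _ (fun heq => hee ?_) t t' h0 h1 h0' h1'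
      exact Subtype.ext (Sym2.map.injective hf (congrArg Subtype.val heq))
    · rw [harc e he, harc' e' he']
      exact (((h e' e'.2 he').2.2.2.2 t' h0' h1').2 ⟨_, he⟩ (hrange e) t h0 h1).symm
    · rw [harc' e he, harc e' he']
      exact ((h e e.2 he).2.2.2.2 t h0 h1).2 ⟨_, he'⟩ (hrange e') t' h0' h1'
    · exact absurd (Subtype.ext ((h e e.2 he).1.trans (h e' e'.2 he').1.symm)) hee

end PlaneDrawing

theorem ConnectedOn.subgraph_connected {S : Set V} (hS : G.ConnectedOn S) :
    ((⊤ : G.Subgraph).induce S).Connected :=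
  connected_induce_iff.1 hS.connected_induce

/-- If the coboundary of `H` consists of at most two vertices, and these are also joined by a path
outside `H`, then the drawing of that path serves for the edge between them. -/
theorem IsPlanar.isPurse [Finite V] (hG : G.IsPlanar) {H : G.Subgraph} (hH : H.Connected)
    (h2 : H.coboundary.ncard ≤ 2)
    (h : ∀ u ∈ H.coboundary, ∀ v ∈ H.coboundary, u ≠ v → ∃ T, G.ConnectedOn T ∧
      Disjoint T (H.coboundary ∪ H.verts) ∧ (∃ x ∈ T, G.Adj x u) ∧ ∃ y ∈ T, G.Adj y v) :
    H.IsPurse := by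
  obtain ⟨D⟩ := hG
  refine ⟨hH, h2, ?_⟩
  have hinj : Function.Injective (Subtype.val : ↥(H.coboundary ∪ H.verts) → V) :=
    Subtype.val_injective
  -- An edge of the closure that is missing in `G` joins two vertices of the coboundary.
  have hmiss : ∀ a b : ↥(H.coboundary ∪ H.verts), H.closureGraph.Adj a b →
      ¬ G.Adj a b → (a : V) ∈ H.coboundary ∧ (b : V) ∈ H.coboundary ∧ (a : V) ≠ b := by
    intro a b hab hno
    rcases hab with hab | hab
    · exact absurd hab hno
    · obtain ⟨hne, hab⟩ := (fromRel_adj _ _ _).1 hab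
      have hne' : (a : V) ≠ b := fun h => hne (Subtype.ext h)
      rcases hab with hab | hab
      exacts [⟨hab.1, hab.2, hne'⟩, ⟨hab.2, hab.1, hne'⟩]
  by_cases hex : ∃ a b : ↥(H.coboundary ∪ H.verts), H.closureGraph.Adj a b ∧ ¬ G.Adj a b
  · obtain ⟨a, b, hab, hno⟩ := hex
    obtain ⟨ha, hb, hne⟩ := hmiss a b hab hno
    have hBab : H.coboundary = {(a : V), (b : V)} := by
      refine (Set.eq_of_subset_of_ncard_le ?_ ?_).symm
      · rintro x (rfl | rfl) <;> assumption
      · rw [Set.ncard_pair hne]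
        exact h2
    obtain ⟨T, hT, hTd, ⟨x, hx, hxa⟩, y, hy, hyb⟩ := h a ha b hb hne
    have hlink : G.LinkedIn (T ∪ {(a : V), (b : V)}) a b := by
      refine (LinkedIn.of_adj hxa.symm (by simp) (Or.inl hx)).trans (LinkedIn.trans
        ((hT.2 hx hy).mono Set.subset_union_left) (LinkedIn.of_adj hyb (Or.inl hy) (by simp)))
    classical
    obtain ⟨p, hp⟩ := hlink
    have hq : ∀ z ∈ p.bypass.support, z ∈ H.coboundary ∪ H.verts → z = a ∨ z = b := by
      intro z hz hzB
      rcases hp z (p.support_bypass_subset_support hz) with h | h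
      · exact absurd hzB (Set.disjoint_left.1 hTd h)
      · exact h
    obtain ⟨γ, hγ, hγt⟩ := D.exists_path_of_isPath _ p.bypass_isPath hne
    refine D.isPlanar_of_extra_arc hinj s(a, b) γ fun e => ?_
    induction e with | _ c d
    intro hcd hcdno
    rw [Sym2.map_mk, mem_edgeSet] at hcdno
    obtain ⟨hc, hd, hcdne⟩ := hmiss c d hcd hcdno
    have hecd : s(c, d) = s(a, b) := by
      rw [Sym2.eq_iff]
      rcases hBab.subset hc with hc | hc <;> rcases hBab.subset hd with hd | hd
      · exact absurd (hc.trans hd.symm) hcdne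
      · exact Or.inl ⟨Subtype.ext hc, Subtype.ext hd⟩
      · exact Or.inr ⟨Subtype.ext hc, Subtype.ext hd⟩
      · exact absurd (hc.trans hd.symm) hcdne
    refine ⟨hecd, γ.continuous, hγ, by rw [hecd, γ.source, γ.target]; rfl, fun t h0 h1 => ?_⟩
    have hγa : γ t ≠ D.point a := fun h => h0.ne' (hγ (h.trans γ.source.symm))
    have hγb : γ t ≠ D.point b := fun h => h1.ne (hγ (h.trans γ.target.symm))
    refine ⟨fun w hw => ?_, fun e he t' h0' h1' heq => ?_⟩
    · rcases hγt t with ⟨z, hz, hzt⟩ | ⟨e, -, t', h0', h1', het⟩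
      · rw [hzt] at hw
        have hzw := D.point_injective hw
        rcases hq z hz (hzw ▸ w.2) with rfl | rfl
        exacts [hγa hzt, hγb hzt]
      · exact D.arc_ne_point e t' h0' h1' w (het ▸ hw)
    · rcases hγt t with ⟨z, hz, hzt⟩ | ⟨e', he', t'', h0'', h1'', het⟩
      · exact D.arc_ne_point e t' h0' h1' z (heq ▸ hzt)
      · have hee : e = e' := by
          by_contra hne'
          exact D.arc_ne_arc e e' hne' t' t'' h0' h1' h0'' h1'' (heq ▸ het)
        subst hee
        obtain ⟨e, hemem⟩ := e
        induction e with | _ c' d'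
        have hc' := hq c' (Walk.fst_mem_support_of_mem_edges _ he')
          (by obtain ⟨w, hw⟩ := he c' (by simp); exact hw ▸ w.2)
        have hd' := hq d' (Walk.snd_mem_support_of_mem_edges _ he')
          (by obtain ⟨w, hw⟩ := he d' (by simp); exact hw ▸ w.2)
        have hadj : G.Adj c' d' := hemem
        rcases hc' with rfl | rfl <;> rcases hd' with rfl | rfl
        exacts [hadj.ne rfl, hno hadj, hno hadj.symm, hadj.ne rfl]
  · push Not at hex
    by_cases hne : Nonempty (Sym2 ↥(H.coboundary ∪ H.verts))
    · refine D.isPlanar_of_extra_arc hinj hne.some (fun _ => 0) fun e => ?_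
      induction e with | _ c d
      intro hcd hno
      exact absurd (hex c d hcd) hno
    · obtain ⟨x, hx⟩ := hH.nonempty
      exact absurd ⟨s(⟨x, Or.inr hx⟩, ⟨x, Or.inr hx⟩)⟩ hne

end SimpleGraph

end AdditionalEdge

namespace SimpleGraph

/-! ### Contraction of components -/

section Components

variable {V : Type*} {G : SimpleGraph V} {W : Set V}

/-- The vertex sets of the components of the subgraph of `G` induced on `W`. -/
def componentSets (G : SimpleGraph V) (W : Set V) : Set (Set V) :=
  {S | ∃ x ∈ W, S = {y | G.LinkedIn W x y}}

theorem subset_of_mem_componentSets {S : Set V} (hS : S ∈ G.componentSets W) : S ⊆ W := by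
  obtain ⟨x, hx, rfl⟩ := hS
  exact fun y hy => LinkedIn.right_mem hy

theorem connectedOn_of_mem_componentSets {S : Set V} (hS : S ∈ G.componentSets W) :
    G.ConnectedOn S := by
  obtain ⟨x, hx, rfl⟩ := hS
  exact .of_center (x := x) (LinkedIn.refl hx) fun y hy =>
    LinkedIn.mono (fun z hz => hz.2) (LinkedIn.linkedIn_component hy)

theorem mem_of_adj_of_mem_componentSets {S : Set V} (hS : S ∈ G.componentSets W) {x y : V}
    (hx : x ∈ S) (hy : y ∈ W) (h : G.Adj x y) : y ∈ S := by
  have hxW := subset_of_mem_componentSets hS hx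
  obtain ⟨z, hz, rfl⟩ := hS
  exact LinkedIn.trans hx (.of_adj h hxW hy)

theorem eq_of_mem_componentSets {S T : Set V} (hS : S ∈ G.componentSets W)
    (hT : T ∈ G.componentSets W) {x : V} (hxS : x ∈ S) (hxT : x ∈ T) : S = T := by
  obtain ⟨y, hy, rfl⟩ := hS
  obtain ⟨z, hz, rfl⟩ := hT
  ext w
  exact ⟨fun h => (LinkedIn.trans hxT (LinkedIn.symm hxS)).trans h,
    fun h => (LinkedIn.trans hxS (LinkedIn.symm hxT)).trans h⟩

theorem disjoint_of_mem_componentSets {S T : Set V} (hS : S ∈ G.componentSets W)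
    (hT : T ∈ G.componentSets W) (hne : S ≠ T) : Disjoint S T :=
  Set.disjoint_left.2 fun _ hx hx' => hne (eq_of_mem_componentSets hS hT hx hx')

/-- The bipartite graph obtained from `G` by contracting the components of the subgraph induced on
`W` and deleting the edges outside `W`. -/
def contractComponents (G : SimpleGraph V) (W : Set V) :
    SimpleGraph (G.componentSets W ⊕ ↥Wᶜ) :=
  SimpleGraph.fromRel fun a b => ∃ c y, a = .inl c ∧ b = .inr y ∧ ∃ x ∈ c.1, G.Adj x y

theorem contractComponents_adj {c : G.componentSets W} {y : ↥Wᶜ} :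
    (G.contractComponents W).Adj (.inl c) (.inr y) ↔ ∃ x ∈ c.1, G.Adj x y := by
  simp only [contractComponents, fromRel_adj]
  constructor
  · rintro ⟨-, ⟨c', y', h1, h2, h⟩ | ⟨c', y', h1, h2, h⟩⟩
    · cases h1
      cases h2
      exact h
    · cases h1
  · exact fun h => ⟨by simp, Or.inl ⟨c, y, rfl, rfl, h⟩⟩

theorem contractComponents_isMinorOf : (G.contractComponents W).IsMinorOf G := by
  refine ⟨Sum.elim (fun c => c.1) fun y => {(y : V)}, ?_, ?_, ?_⟩
  · rintro (c | y)
    exacts [connectedOn_of_mem_componentSets c.2, .singleton _]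
  · rintro (c | y) (c' | y') hne
    · exact disjoint_of_mem_componentSets c.2 c'.2 fun h => hne (by rw [Subtype.ext h])
    · exact Set.disjoint_singleton_right.2 fun h => y'.2 (subset_of_mem_componentSets c.2 h)
    · exact Set.disjoint_singleton_left.2 fun h => y.2 (subset_of_mem_componentSets c'.2 h)
    · exact Set.disjoint_singleton.2 fun h => hne (by rw [Subtype.ext h])
  · rintro a b hab
    obtain ⟨-, ⟨c, y, rfl, rfl, x, hx, hxy⟩ | ⟨c, y, rfl, rfl, x, hx, hxy⟩⟩ :=
      (fromRel_adj _ _ _).1 hab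
    · exact ⟨x, hx, y, rfl, hxy⟩
    · exact ⟨y, rfl, x, hx, hxy.symm⟩

theorem coboundary_induce_eq_image [Fintype ↥Wᶜ] (c : G.componentSets W) :
    ((⊤ : G.Subgraph).induce c.1).coboundary =
      Subtype.val '' ((G.contractComponents W).rightNeighbors c : Set ↥Wᶜ) := by
  ext y
  constructor
  · rintro ⟨hy, x, hx, hxy⟩
    have hyW : y ∉ W := fun h => hy (mem_of_adj_of_mem_componentSets c.2 hx h hxy)
    exact ⟨⟨y, hyW⟩, mem_rightNeighbors.2 (contractComponents_adj.2 ⟨x, hx, hxy⟩), rfl⟩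
  · rintro ⟨y, hy, rfl⟩
    obtain ⟨x, hx, hxy⟩ := contractComponents_adj.1 (mem_rightNeighbors.1 hy)
    exact ⟨fun h => y.2 (subset_of_mem_componentSets c.2 h), x, hx, hxy⟩

theorem ncard_coboundary_induce [Fintype ↥Wᶜ] (c : G.componentSets W) :
    ((⊤ : G.Subgraph).induce c.1).coboundary.ncard =
      ((G.contractComponents W).rightNeighbors c).card := by
  rw [coboundary_induce_eq_image, Set.ncard_image_of_injective _ Subtype.val_injective,
    Set.ncard_coe_finset]

end Components

/-! ### Counting components -/

section Counting

open Finset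
open scoped Classical

variable {V : Type*} [Fintype V] {G : SimpleGraph V} {W : Finset V}

/-- A component with at most two neighbours is a purse, if some other component has the same two:
these are then joined by a path through the other component. -/
theorem IsPlanar.isPurse_of_rightNeighbors_subset (hG : G.IsPlanar)
    {c : G.componentSets (W : Set V)}
    (h2 : #((G.contractComponents (W : Set V)).rightNeighbors c) ≤ 2)
    (h : #((G.contractComponents (W : Set V)).rightNeighbors c) = 2 → ∃ d ≠ c,
      (G.contractComponents (W : Set V)).rightNeighbors c ⊆
        (G.contractComponents (W : Set V)).rightNeighbors d) :
    ((⊤ : G.Subgraph).induce c.1).IsPurse := by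
  refine hG.isPurse (connectedOn_of_mem_componentSets c.2).subgraph_connected
    (by rwa [ncard_coboundary_induce]) fun u hu v hv huv => ?_
  rw [coboundary_induce_eq_image] at hu hv
  obtain ⟨u, hu, rfl⟩ := hu
  obtain ⟨v, hv, rfl⟩ := hv
  have huv' : u ≠ v := fun h => huv (by rw [h])
  have h1 := one_lt_card.2 ⟨u, hu, v, hv, huv'⟩
  obtain ⟨d, hdc, hd⟩ := h (by omega)
  refine ⟨d.1, connectedOn_of_mem_componentSets d.2, ?_,
    contractComponents_adj.1 (mem_rightNeighbors.1 (hd hu)),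
    contractComponents_adj.1 (mem_rightNeighbors.1 (hd hv))⟩
  rw [Set.disjoint_union_right, coboundary_induce_eq_image]
  refine ⟨Set.disjoint_left.2 ?_, disjoint_of_mem_componentSets d.2 c.2
    fun h => hdc (Subtype.ext h)⟩
  rintro x hx ⟨y, -, rfl⟩
  exact y.2 (subset_of_mem_componentSets d.2 hx)

/-- Among the components of the subgraph induced on `W`, those that are no purses have together few
neighbours: they have at least three neighbours, or they have two, and then no other component is
adjacent to both. -/
theorem IsPlanar.sum_card_rightNeighbors_le (hG : G.IsPlanar) (W : Finset V) :
    ∑ c : G.componentSets (W : Set V) with ¬ ((⊤ : G.Subgraph).induce c.1).IsPurse,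
      #((G.contractComponents (W : Set V)).rightNeighbors c) ≤ 532544 * #Wᶜ := by
  set Γ := G.contractComponents (W : Set V)
  have hΓ : Γ.K33MinorFree := hG.k33MinorFree.of_isMinorOf contractComponents_isMinorOf
  set E : Finset (G.componentSets (W : Set V)) :=
    {c | ¬ ((⊤ : G.Subgraph).induce c.1).IsPurse}
  have hY : Fintype.card ↥(W : Set V)ᶜ = #Wᶜ := by
    rw [← Set.toFinset_card]
    congr 1
    ext x
    simp
  have h3 : #{c ∈ E | 3 ≤ #(Γ.rightNeighbors c)} ≤ 8256 * #Wᶜ := by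
    rw [← hY]
    exact hΓ.card_le_of_three_le fun c hc => (mem_filter.1 hc).2
  have h2 : #{c ∈ E | ¬ 3 ≤ #(Γ.rightNeighbors c)} ≤ 64 * #Wᶜ := by
    have hprop : ∀ c ∈ ({c ∈ E | ¬ 3 ≤ #(Γ.rightNeighbors c)} : Finset _),
        #(Γ.rightNeighbors c) = 2 ∧ ∀ d, Γ.rightNeighbors c ⊆ Γ.rightNeighbors d → c = d := by
      intro c hc
      obtain ⟨hc, hc3⟩ := mem_filter.1 hc
      have hnp := (mem_filter.1 hc).2
      by_contra hcon
      refine hnp (hG.isPurse_of_rightNeighbors_subset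
        (Nat.le_of_lt_succ (not_le.1 hc3)) fun h => ?_)
      by_contra! hno
      exact hcon ⟨h, fun d hd => by
        by_contra hcd
        exact hno d (Ne.symm hcd) hd⟩
    rcases ({c ∈ E | ¬ 3 ≤ #(Γ.rightNeighbors c)} : Finset _).eq_empty_or_nonempty
      with he | ⟨c₀, h₀⟩
    · rw [he]
      simp
    obtain ⟨u₀, v₀, -, -⟩ := card_eq_two.1 (hprop c₀ h₀).1
    have hp : ∀ c, ∃ p : Sym2 ↥(W : Set V)ᶜ, #(Γ.rightNeighbors c) = 2 →
        ¬ p.IsDiag ∧ ∀ y, y ∈ Γ.rightNeighbors c ↔ y ∈ p := fun c => by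
      by_cases hc : #(Γ.rightNeighbors c) = 2
      · obtain ⟨u, v, huv, h⟩ := card_eq_two.1 hc
        exact ⟨s(u, v), fun _ => ⟨by simpa using huv, fun y => by rw [h]; simp⟩⟩
      · exact ⟨s(u₀, v₀), fun h => absurd h hc⟩
    choose p hp using hp
    rw [← hY]
    refine hΓ.card_le_of_injOn (p := p) (fun c hc y hy => ((hp c (hprop c hc).1).2 y).2 hy)
      (fun c hc => (hp c (hprop c hc).1).1) fun c hc d hd hcd => ?_
    refine (hprop c hc).2 d fun y hy => ?_
    rw [(hp d (hprop d hd).1).2, ← hcd]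
    exact ((hp c (hprop c hc).1).2 y).1 hy
  -- The constant is `64 * (8256 + 64 + 1)`.
  have hE := card_filter_add_card_filter_not (s := E) fun c => 3 ≤ #(Γ.rightNeighbors c)
  have h := hΓ.sum_card_rightNeighbors_le E
  rw [hY] at h
  omega

theorem card_le_sum_ncard_componentSets (G : SimpleGraph V) (W : Finset V) :
    #W ≤ ∑ c : G.componentSets (W : Set V), c.1.ncard := by
  calc #W ≤ #((univ : Finset (G.componentSets (W : Set V))).biUnion fun c => c.1.toFinset) := by
        refine card_le_card fun x hx => mem_biUnion.2 ?_
        exact ⟨⟨_, x, hx, rfl⟩, mem_univ _, Set.mem_toFinset.2 (LinkedIn.refl hx)⟩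
    _ ≤ ∑ c : G.componentSets (W : Set V), #c.1.toFinset := card_biUnion_le
    _ = _ := sum_congr rfl fun c _ => (Set.ncard_eq_toFinset_card' _).symm

/-- There are few vertices of large degree. -/
theorem K33MinorFree.card_filter_lt_degree_le (hG : G.K33MinorFree) (D : ℕ) :
    D * #{x | D < #{y | G.Adj x y}} ≤ 64 * Fintype.card V := by
  have h := hG.degreeSumOn_le univ
  rw [card_univ] at h
  refine le_trans ?_ h
  rw [mul_comm, ← smul_eq_mul]
  calc _ ≤ ∑ x ∈ ({x | D < #{y | G.Adj x y}} : Finset V), #{y | G.Adj x y} :=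
        card_nsmul_le_sum _ _ _ fun x hx => (mem_filter.1 hx).2.le
    _ ≤ _ := sum_le_sum_of_subset (subset_univ _)

/-- The components of the subgraph induced on `W` that are purses or deep form a wallet, if there
are few vertices outside `W`, the components are small, and the degrees in `W` are small. Every
other component has fewer than `k` times as many vertices as neighbours, so that these components
and `Wᶜ` have together at most `(532544 * K + 1) * #Wᶜ` vertices, which is at most half of all. -/
theorem IsPlanar.exists_isDeepWallet (hG : G.IsPlanar) {k : ℝ} (hk : 1 ≤ k) {K N : ℕ}
    (hkK : k ≤ K) (hN : 0 < N) (hcompl : 1065090 * K * #Wᶜ ≤ Fintype.card V)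
    (hdeg : ∀ x ∈ W, #{y | G.Adj x y} ≤ N)
    (hcomp : ∀ x, #{y | G.LinkedIn (W : Set V) x y} ≤ N) :
    ∃ ℋ : Set G.Subgraph, G.IsDeepWallet k N ℋ := by
  have hk0 : 0 < k := by linarith
  let H : G.componentSets (W : Set V) → G.Subgraph := fun c => (⊤ : G.Subgraph).induce c.1
  have hHinj : Function.Injective H := fun c d h => Subtype.ext (congrArg Subgraph.verts h)
  have hsize : ∀ c : G.componentSets (W : Set V), c.1.ncard ≤ N := by
    rintro ⟨S, x, hx, rfl⟩
    refine le_trans (le_of_eq ?_) (hcomp x)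
    rw [← Set.ncard_coe_finset]
    congr 1
    ext y
    simp
  let P : Finset (G.componentSets (W : Set V)) := {c | (H c).IsPurse ∨ (H c).IsDeep k}
  refine ⟨H '' (P : Set _), ⟨?_, ?_, ?_, ?_⟩, ?_⟩
  · rintro _ ⟨c, -, rfl⟩ x hx y hy hxy
    exact ⟨hx, hy, hxy⟩
  · rintro _ ⟨c, -, rfl⟩
    refine ⟨(connectedOn_of_mem_componentSets c.2).subgraph_connected,
      Nat.cast_le.2 (hsize c), fun v hv => Nat.cast_le.2 ?_⟩
    refine le_trans (le_of_eq ?_) (hdeg v (subset_of_mem_componentSets c.2 hv))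
    rw [← Set.ncard_coe_finset]
    congr 1
    ext y
    simp
  · rintro _ ⟨c, -, rfl⟩ _ ⟨d, -, rfl⟩ hne
    have hcd : c.1 ≠ d.1 := fun h => hne (by rw [Subtype.ext h])
    refine ⟨disjoint_of_mem_componentSets c.2 d.2 hcd, fun x hx y hy hxy => hcd ?_⟩
    exact eq_of_mem_componentSets c.2 d.2
      (mem_of_adj_of_mem_componentSets c.2 hx (subset_of_mem_componentSets d.2 hy) hxy) hy
  · rw [Set.ncard_image_of_injective _ hHinj, Set.ncard_coe_finset]
    have h1 := G.card_le_sum_ncard_componentSets W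
    rw [← sum_filter_add_sum_filter_not univ (fun c => c ∈ P)] at h1
    have h2 : ∑ c : G.componentSets (W : Set V) with c ∈ P, c.1.ncard ≤ #P * N := by
      rw [filter_mem_eq_inter, univ_inter, ← smul_eq_mul]
      exact sum_le_card_nsmul _ _ _ fun c _ => hsize c
    have h3 : ∑ c : G.componentSets (W : Set V) with ¬ c ∈ P, c.1.ncard ≤
        K * (532544 * #Wᶜ) := by
      refine le_trans ?_ (Nat.mul_le_mul_left K (hG.sum_card_rightNeighbors_le W))
      rw [mul_sum]
      refine le_trans (sum_le_sum fun c hc => ?_) (sum_le_sum_of_subset fun c hc => ?_)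
      · have hcP : ¬ ((H c).IsPurse ∨ (H c).IsDeep k) := by simpa [P] using hc
        push Not at hcP
        obtain ⟨hnp, hnd⟩ := hcP
        have hcob := ncard_coboundary_induce c
        have hne : (H c).coboundary.Nonempty := by
          rw [← Set.ncard_pos (Set.toFinite _), hcob]
          by_contra h0
          exact hnp (hG.isPurse_of_rightNeighbors_subset (by omega) fun h => by omega)
        have hlt : (1 / k * (c.1.ncard : ℝ)) < ((H c).coboundary.ncard : ℝ) := by
          by_contra! hle
          exact hnd ⟨hne, hle⟩
        rw [one_div, inv_mul_lt_iff₀ hk0, hcob] at hlt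
        have : (c.1.ncard : ℝ) ≤
            K * #((G.contractComponents (W : Set V)).rightNeighbors c) :=
          hlt.le.trans (mul_le_mul_of_nonneg_right hkK (Nat.cast_nonneg _))
        exact_mod_cast this
      · have hcP : ¬ ((H c).IsPurse ∨ (H c).IsDeep k) := by simpa [P] using hc
        exact mem_filter.2 ⟨mem_univ _, fun h => hcP (Or.inl h)⟩
    have h4 := card_add_card_compl W
    have hK1 : 1 ≤ K := by exact_mod_cast hk.trans hkK
    have h5 : Fintype.card V ≤ 2 * N * #P := by
      have := Nat.mul_le_mul_right (#Wᶜ) hK1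
      nlinarith
    have hNR : (0 : ℝ) < 2 * N := by positivity
    rw [one_div, inv_mul_le_iff₀ hNR, Nat.card_eq_fintype_card]
    exact_mod_cast h5
  · rintro _ ⟨c, hc, rfl⟩
    exact (mem_filter.1 hc).2

end Counting

end SimpleGraph

/-! ### Choice of the constants -/

open SimpleGraph in
/-- The vertices of degree more than `128 * Q` make up at most a fraction `1 / (2 * Q)` of all
vertices, and so do the vertices deleted in chopping the rest with `Δ = 6 * Q`. -/
theorem exists_natCast_isDeepWallet (k : ℝ) (hk : 1 ≤ k) :
    ∃ N : ℕ, 0 < N ∧ ∀ (V : Type*) [Finite V] (G : SimpleGraph V), G.IsPlanar →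
      ∃ ℋ : Set G.Subgraph, G.IsDeepWallet k N ℋ := by
  classical
  obtain ⟨K, hK⟩ := exists_nat_ge k
  have hK1 : 1 ≤ K := by exact_mod_cast hk.trans hK
  obtain ⟨Q, hQ⟩ : ∃ Q, Q = 1065090 * K := ⟨_, rfl⟩
  have hQ0 : 0 < Q := by omega
  refine ⟨2 * (128 * Q + 1) ^ (18 * (6 * Q) + 18), by positivity, fun V _ G hG => ?_⟩
  have := Fintype.ofFinite V
  let W₀ : Finset V := {x | ¬ 128 * Q < Finset.card {y | G.Adj x y}}
  have hW₀ : ∀ x ∈ W₀, Finset.card {y | G.Adj x y} ≤ 128 * Q := fun x hx =>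
    not_lt.1 (Finset.mem_filter.1 hx).2
  have h1 := hG.k33MinorFree.card_filter_lt_degree_le (128 * Q)
  obtain ⟨W, hW, hcard, hcomp⟩ := hG.k33MinorFree.exists_small_components (Δ := 6 * Q)
    (by omega) hW₀
  refine hG.exists_isDeepWallet (W := W) hk hK (by positivity) ?_ (fun x hx => ?_) hcomp
  · have h2 : Finset.card {x : V | 128 * Q < Finset.card {y | G.Adj x y}} + W₀.card =
        Fintype.card V := Finset.card_filter_add_card_filter_not _
    have h3 := Finset.card_sdiff_add_card_eq_card hW
    have h4 := Finset.card_add_card_compl W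
    rw [← hQ]
    have h5 : Wᶜ.card = Finset.card {x : V | 128 * Q < Finset.card {y | G.Adj x y}} +
        (W₀ \ W).card := by omega
    rw [h5]
    nlinarith
  · refine (hW₀ x (hW hx)).trans ?_
    have : 128 * Q + 1 ≤ (128 * Q + 1) ^ (18 * (6 * Q) + 18) := Nat.le_self_pow (by omega) _
    omega

theorem mainTheorem6 (k : ℝ) (hk : 1 ≤ k) :
    ∃ C : ℝ, 0 < C ∧ ∀ (V : Type*) [Finite V] (G : SimpleGraph V), G.IsPlanar →
      ∃ ℋ : Set G.Subgraph, G.IsDeepWallet k C ℋ := by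
  obtain ⟨N, hN, h⟩ := exists_natCast_isDeepWallet k hk
  exact ⟨N, Nat.cast_pos.2 hN, h⟩
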